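/- **Eisenstein series and non-abelian zeta functions.** Let $r\ge 1$. A lattice $\Lambda$ of rank $r$ is a discrete subgroup of Euclidean $\mathbb R^r$ spanning $\mathbb R^r$; $\mathrm{Vol}\,\Lambda$ is the volume of $\mathbb R^r/\Lambda$, and the volume of a sublattice $\Lambda_1\subseteq\Lambda$ of smaller rank is its covolume in the Euclidean subspace that it spans. $\Lambda$ is *semistable* if $(\mathrm{Vol}\,\Lambda_1)^{\mathrm{rank}\,\Lambda}\ge(\mathrm{Vol}\,\Lambda)^{\mathrm{rank}\,\Lambda_1}$ for every sublattice $\Lambda_1\subseteq\Lambda$. Put $$h^0(\mathbb Q,\Lambda)=\log\sum_{x\in\Lambda}e^{-\pi|x|^2},\qquad \deg\Lambda=-\log\mathrm{Vol}\,\Lambda,\qquad \hat E(\Lambda;s)=\pi^{-s}\,\Gamma(s)\sum_{x\in\Lambda\setminus\{0\}}|x|^{-2s}.$$ Let $\mathcal M_{\mathbb Q,r}$ be the moduli space of isometry classes of semistable lattices of rank $r$, a subset of the space $GL_r(\mathbb Z)\backslash GL_r(\mathbb R)/O(r)$ of all isometry classes of lattices of rank $r$, and let $\mathcal M_{\mathbb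 Q,r}[1]$ be its subset of lattices of volume $1$. Let $\mu$ be the measure on $GL_r(\mathbb Z)\backslash GL_r(\mathbb R)/O(r)$ induced by a Haar measure of $GL_r(\mathbb R)$ (such as the one coming from the Tamagawa measure; the normalization is arbitrary), i.e. the image of the quotient measure on $GL_r(\mathbb Z)\backslash GL_r(\mathbb R)$. Let $\mu_1$ be the induced measure on the space of lattices of volume $1$, i.e. the factor $\mu_1$ of $\mu=\frac{dT}{T}\otimes\mu_1$ under $(T,\Lambda)\mapsto T^{1/r}\Lambda$; explicitly $\mu_1(A)=\mu\{\Lambda : 1\le \mathrm{Vol}\,\Lambda<e,\ (\mathrm{Vol}\,\Lambda)^{-1/r}\Lambda\in A\}$. For $\mathrm{Re}(s)>1$ the rank $r$ non-abelian zeta function of $\mathbb Q$ is $$\xi_{\mathbb Q,r}(s)=\int_{\mathcal M_{\mathbb Q,r}}\bigl(e^{h^0(\mathbb Q,\Lambda)}-1\bigr)\,e^{-s\deg\Lambda}\,d\mu(\Lambda).$$ Then for $\mathrm{Re}(s)>1$ this integral and the one below converge absolutely, the series defining $h^0(\mathbb Q,\Lambda)$ and $\hat E(\Lambda,\tfrac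 r2 s)$ converge absolutely for every lattice $\Lambda$ of rank $r$, and $$\xi_{\mathbb Q,r}(s)=\frac r2\int_{\mathcal M_{\mathbb Q,r}[1]}\hat E\bigl(\Lambda,\tfrac r2 s\bigr)\,d\mu_1(\Lambda).$$ -/

import Mathlib

open MeasureTheory

open scoped Matrix

noncomputable section

namespace NonAbelianZeta

/-! ### Lattices in Euclidean space -/

/-- A lattice of rank `r`: a discrete subgroup of `ℝ^r` (with its Euclidean structure) spanning
`ℝ^r` over `ℝ`. -/
@[ext]
structure EuclideanLattice (r : ℕ) where
  /-- The underlying subgroup of `ℝ^r`. -/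
  carrier : Submodule ℤ (EuclideanSpace ℝ (Fin r))
  [discrete : DiscreteTopology carrier]
  [isZLattice : IsZLattice ℝ carrier]

attribute [instance] EuclideanLattice.discrete EuclideanLattice.isZLattice

/-- The covolume of `L` inside a linear subspace `S` of `ℝ^r`, for the Lebesgue measure of the
Euclidean space `S` (the Haar measure giving mass one to the unit cube of an orthonormal basis). -/
def covolumeIn {r : ℕ} (S : Submodule ℝ (EuclideanSpace ℝ (Fin r)))
    (L : Submodule ℤ (EuclideanSpace ℝ (Fin r))) : ℝ :=
  ZLattice.covolume (ZLattice.comap ℝ L S.subtype) (stdOrthonormalBasis ℝ S).toBasis.addHaar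

/-- The volume of a sublattice, not necessarily of full rank: its covolume inside the real
subspace that it spans. -/
def sublatticeVol {r : ℕ} (L : Submodule ℤ (EuclideanSpace ℝ (Fin r))) : ℝ :=
  covolumeIn (Submodule.span ℝ (L : Set (EuclideanSpace ℝ (Fin r)))) L

namespace EuclideanLattice

variable {r : ℕ}

/-- `Vol Λ = Vol(ℝ^r / Λ)`. -/
def vol (Λ : EuclideanLattice r) : ℝ := ZLattice.covolume Λ.carrier

theorem vol_pos (Λ : EuclideanLattice r) : 0 < Λ.vol := ZLattice.covolume_pos Λ.carrier volume

/-- `Λ` is semistable when `(Vol Λ₁)^(rank Λ) ≥ (Vol Λ)^(rank Λ₁)` for all sublattices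
`Λ₁ ⊆ Λ`. -/
def IsSemistable (Λ : EuclideanLattice r) : Prop :=
  ∀ Λ₁ : Submodule ℤ (EuclideanSpace ℝ (Fin r)), Λ₁ ≤ Λ.carrier →
    Λ.vol ^ Module.finrank ℤ Λ₁ ≤ sublatticeVol Λ₁ ^ Module.finrank ℤ Λ.carrier

/-- `h⁰(ℚ, Λ) = log ∑_{x ∈ Λ} exp(-π |x|²)`. -/
def h0 (Λ : EuclideanLattice r) : ℝ :=
  Real.log (∑' x : Λ.carrier, Real.exp (-Real.pi * ‖x‖ ^ 2))

/-- The completed Epstein zeta function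
`Ê(Λ; s) = π^{-s} Γ(s) ∑_{x ∈ Λ, x ≠ 0} |x|^{-2s}`. -/
def completedEpstein (Λ : EuclideanLattice r) (s : ℂ) : ℂ :=
  (Real.pi : ℂ) ^ (-s) * Complex.Gamma s *
    ∑' x : {x : Λ.carrier // x ≠ 0}, (‖(x : Λ.carrier)‖ : ℂ) ^ (-2 * s)

/-- The image `e(Λ)` of `Λ` under an invertible linear map `e`. -/
def map (Λ : EuclideanLattice r)
    (e : EuclideanSpace ℝ (Fin r) ≃L[ℝ] EuclideanSpace ℝ (Fin r)) : EuclideanLattice r :=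
  ⟨ZLattice.comap ℝ Λ.carrier e.symm.toLinearMap⟩

theorem mem_map {Λ : EuclideanLattice r}
    {e : EuclideanSpace ℝ (Fin r) ≃L[ℝ] EuclideanSpace ℝ (Fin r)}
    {x : EuclideanSpace ℝ (Fin r)} : x ∈ (Λ.map e).carrier ↔ e.symm x ∈ Λ.carrier := Iff.rfl

theorem map_map (Λ : EuclideanLattice r)
    (e f : EuclideanSpace ℝ (Fin r) ≃L[ℝ] EuclideanSpace ℝ (Fin r)) :
    (Λ.map e).map f = Λ.map (e.trans f) := by
  ext x; rfl

/-- Isometry of lattices. -/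
def Isometric (Λ Λ' : EuclideanLattice r) : Prop :=
  ∃ φ : EuclideanSpace ℝ (Fin r) ≃ₗᵢ[ℝ] EuclideanSpace ℝ (Fin r),
    Λ.map φ.toContinuousLinearEquiv = Λ'

/-- Lattices up to isometry. -/
instance setoid (r : ℕ) : Setoid (EuclideanLattice r) where
  r := Isometric
  iseqv :=
    { refl := fun Λ => ⟨LinearIsometryEquiv.refl ℝ _, by ext x; rfl⟩
      symm := by
        rintro Λ _ ⟨φ, rfl⟩
        refine ⟨φ.symm, ?_⟩
        ext x
        simp [mem_map]
      trans := by
        rintro Λ _ _ ⟨φ, rfl⟩ ⟨ψ, rfl⟩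
        exact ⟨φ.trans ψ, by ext x; rfl⟩ }

theorem vol_eq_of_isometric {Λ Λ' : EuclideanLattice r} (h : Isometric Λ Λ') :
    Λ.vol = Λ'.vol := by
  obtain ⟨φ, rfl⟩ := h
  exact (ZLattice.covolume_comap Λ.carrier volume volume
    (e := φ.toContinuousLinearEquiv.symm) φ.symm.measurePreserving).symm

/-- The norm-preserving bijection between isometric lattices. -/
theorem exists_equiv_of_isometric {Λ Λ' : EuclideanLattice r} (h : Isometric Λ Λ') :
    ∃ e : Λ.carrier ≃+ Λ'.carrier, ∀ x, ‖e x‖ = ‖x‖ := by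
  obtain ⟨φ, rfl⟩ := h
  exact ⟨{ toFun := fun x => ⟨φ x, by simp [mem_map]⟩
           invFun := fun x => ⟨φ.symm x, x.2⟩
           left_inv := fun x => by simp
           right_inv := fun x => by simp
           map_add' := fun x y => by ext; simp }, fun x => φ.norm_map x⟩

theorem h0_eq_of_isometric {Λ Λ' : EuclideanLattice r} (h : Isometric Λ Λ') :
    Λ.h0 = Λ'.h0 := by
  obtain ⟨e, he⟩ := exists_equiv_of_isometric h
  unfold h0
  rw [← e.toEquiv.tsum_eq]
  simp [he]

theorem completedEpstein_eq_of_isometric {Λ Λ' : EuclideanLattice r} (h : Isometric Λ Λ') :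
    Λ.completedEpstein = Λ'.completedEpstein := by
  obtain ⟨e, he⟩ := exists_equiv_of_isometric h
  funext s
  unfold completedEpstein
  rw [← (e.toEquiv.subtypeEquiv (p := fun x => x ≠ 0) (q := fun x => x ≠ 0)
    (fun x => by simp)).tsum_eq]
  simp [he]

/-- The lattice `t • Λ`. -/
def scale (t : ℝˣ) (Λ : EuclideanLattice r) : EuclideanLattice r :=
  Λ.map (ContinuousLinearEquiv.smulLeft t)

theorem scale_isometric (t : ℝˣ) {Λ Λ' : EuclideanLattice r} (h : Isometric Λ Λ') :
    Isometric (scale t Λ) (scale t Λ') := by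
  obtain ⟨φ, rfl⟩ := h
  refine ⟨φ, ?_⟩
  unfold scale
  rw [map_map, map_map]
  congr 1
  ext1
  funext x
  exact φ.map_smul (t : ℝ) x

/-- The lattice of volume one that is homothetic to `Λ`, namely `(Vol Λ)^{-1/r} • Λ`. -/
def normalize (Λ : EuclideanLattice r) : EuclideanLattice r :=
  scale (Units.mk0 (Λ.vol ^ (-(1 / (r : ℝ)))) (Real.rpow_pos_of_pos Λ.vol_pos _).ne') Λ

theorem normalize_isometric {Λ Λ' : EuclideanLattice r} (h : Isometric Λ Λ') :
    Isometric (normalize Λ) (normalize Λ') := by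
  unfold normalize
  simp only [vol_eq_of_isometric h]
  exact scale_isometric _ h

theorem exists_rowBasis (g : GL (Fin r) ℝ) :
    ∃ b : Module.Basis (Fin r) ℝ (EuclideanSpace ℝ (Fin r)),
      (b : Fin r → EuclideanSpace ℝ (Fin r)) =
        fun i => WithLp.toLp 2 ((g : Matrix (Fin r) (Fin r) ℝ) i) := by
  have hli : LinearIndependent ℝ
      (fun i => WithLp.toLp 2 ((g : Matrix (Fin r) (Fin r) ℝ) i) :
        Fin r → EuclideanSpace ℝ (Fin r)) :=
    (Matrix.linearIndependent_rows_of_isUnit (Units.isUnit g)).map'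
      (WithLp.linearEquiv 2 ℝ (Fin r → ℝ)).symm.toLinearMap (LinearEquiv.ker _)
  exact ⟨basisOfLinearIndependentOfCardEqFinrank' _ hli (by simp), by simp⟩

/-- The lattice `ℤ^r g` generated by the rows of an invertible matrix `g`. -/
def ofGL (g : GL (Fin r) ℝ) : EuclideanLattice r :=
  have hd : DiscreteTopology (Submodule.span ℤ
      (Set.range fun i => WithLp.toLp 2 ((g : Matrix (Fin r) (Fin r) ℝ) i))) := by
    obtain ⟨b, hb⟩ := exists_rowBasis g
    rw [← hb]
    infer_instance
  { carrier := Submodule.span ℤ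
      (Set.range fun i => WithLp.toLp 2 ((g : Matrix (Fin r) (Fin r) ℝ) i))
    discrete := hd
    isZLattice := ⟨by
      obtain ⟨b, hb⟩ := exists_rowBasis g
      rw [← hb]
      exact ZSpan.span_top b⟩ }

end EuclideanLattice

/-! ### The moduli space of lattices and its measures -/

/-- The space of isometry classes of lattices of rank `r`, that is
`GL_r(ℤ) \ GL_r(ℝ) / O(r)`. -/
def Moduli (r : ℕ) : Type := Quotient (EuclideanLattice.setoid r)

/-- The class of the lattice `ℤ^r g`. -/
def Moduli.ofGL {r : ℕ} (g : GL (Fin r) ℝ) : Moduli r :=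
  Quotient.mk _ (EuclideanLattice.ofGL g)

instance (r : ℕ) : MeasurableSpace (GL (Fin r) ℝ) := borel _

instance (r : ℕ) : BorelSpace (GL (Fin r) ℝ) := ⟨rfl⟩

/-- The quotient `σ`-algebra: a set of classes is measurable when its preimage in `GL_r(ℝ)` is
Borel. -/
instance (r : ℕ) : MeasurableSpace (Moduli r) := MeasurableSpace.map Moduli.ofGL inferInstance

/-- `GL_r(ℤ)` as a subgroup of `GL_r(ℝ)`; it acts on `GL_r(ℝ)` by left multiplication. -/
def integralGL (r : ℕ) : Subgroup (GL (Fin r) ℝ) :=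
  (Matrix.GeneralLinearGroup.map (Int.castRingHom ℝ)).range

instance (r : ℕ) : Countable (integralGL r) := by
  have : Countable (GL (Fin r) ℤ) := by
    have : Countable (Matrix (Fin r) (Fin r) ℤ) :=
      inferInstanceAs (Countable (Fin r → Fin r → ℤ))
    exact (Units.val_injective (α := Matrix (Fin r) (Fin r) ℤ)).countable
  exact (MonoidHom.rangeRestrict_surjective
    (Matrix.GeneralLinearGroup.map (n := Fin r) (Int.castRingHom ℝ))).countable

instance (r : ℕ) : SecondCountableTopology (GL (Fin r) ℝ) := by
  have : SecondCountableTopology (Matrix (Fin r) (Fin r) ℝ) :=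
    inferInstanceAs (SecondCountableTopology (Fin r → Fin r → ℝ))
  have : SecondCountableTopology (Matrix (Fin r) (Fin r) ℝ)ᵐᵒᵖ :=
    MulOpposite.opHomeomorph.symm.secondCountableTopology
  exact Units.isEmbedding_embedProduct.secondCountableTopology

/-- `GL_r(ℤ)` is discrete: the identity has a neighbourhood whose translates `V g` meet each
orbit at most once. -/
theorem exists_small_nhds (r : ℕ) : ∃ V : Set (GL (Fin r) ℝ), IsOpen V ∧ 1 ∈ V ∧
    ∀ γ ∈ integralGL r, ∀ v ∈ V, ∀ w ∈ V, γ = v * w⁻¹ → γ = 1 := by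
  let U : Set (GL (Fin r) ℝ) :=
    {g | ∀ i j, |(g : Matrix (Fin r) (Fin r) ℝ) i j - (1 : Matrix (Fin r) (Fin r) ℝ) i j| < 1}
  have hU : IsOpen U := by
    simp only [U, Set.ofPred_forall]
    refine isOpen_iInter_of_finite fun i => isOpen_iInter_of_finite fun j => ?_
    exact isOpen_lt (((Units.continuous_val.matrix_elem i j).sub continuous_const).abs)
      continuous_const
  have hU1 : ∀ γ ∈ integralGL r, γ ∈ U → γ = 1 := by
    rintro _ ⟨γ, rfl⟩ h
    ext i j
    have h1 := h i j
    have h2 : ((Matrix.GeneralLinearGroup.map (Int.castRingHom ℝ) γ : GL (Fin r) ℝ) :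
        Matrix (Fin r) (Fin r) ℝ) i j = ((γ : Matrix (Fin r) (Fin r) ℤ) i j : ℝ) := rfl
    have h3 : (1 : Matrix (Fin r) (Fin r) ℝ) i j = ((1 : Matrix (Fin r) (Fin r) ℤ) i j : ℝ) := by
      by_cases hij : i = j <;> simp [Matrix.one_apply, hij]
    rw [h2, h3] at h1
    rw [Units.val_one, h2, h3]
    have h4 : |(γ : Matrix (Fin r) (Fin r) ℤ) i j - (1 : Matrix (Fin r) (Fin r) ℤ) i j| < 1 := by
      exact_mod_cast h1
    have h5 := Int.abs_lt_one_iff.mp h4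
    congr 1
    omega
  have hc : Continuous fun p : GL (Fin r) ℝ × GL (Fin r) ℝ => p.1 * p.2⁻¹ := by fun_prop
  have h1 : (fun p : GL (Fin r) ℝ × GL (Fin r) ℝ => p.1 * p.2⁻¹) ⁻¹' U ∈
      nhds ((1 : GL (Fin r) ℝ), (1 : GL (Fin r) ℝ)) :=
    (hU.preimage hc).mem_nhds (by simp [U])
  rw [nhds_prod_eq, Filter.mem_prod_same_iff] at h1
  obtain ⟨t, ht, hts⟩ := h1
  obtain ⟨V, hVt, hV, hV1⟩ := mem_nhds_iff.mp ht
  refine ⟨V, hV, hV1, fun γ hγ v hv w hw h => hU1 γ hγ ?_⟩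
  rw [h]
  exact hts (Set.mk_mem_prod (hVt hv) (hVt hw))

/-- `GL_r(ℤ)` has a measurable strict fundamental domain in `GL_r(ℝ)`. -/
theorem exists_fundamentalDomain (r : ℕ) : ∃ F : Set (GL (Fin r) ℝ), MeasurableSet F ∧
    ∀ g : GL (Fin r) ℝ, ∃! γ : integralGL r, γ • g ∈ F := by
  obtain ⟨V, hV, hV1, hVΓ⟩ := exists_small_nhds r
  let W : GL (Fin r) ℝ → Set (GL (Fin r) ℝ) := fun h => (fun g => g * h⁻¹) ⁻¹' V
  have hW : ∀ h, IsOpen (W h) := fun h => hV.preimage (continuous_mul_const _)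
  obtain ⟨u, hu⟩ := TopologicalSpace.exists_dense_seq (GL (Fin r) ℝ)
  have hcover : ∀ g, ∃ n, g ∈ W (u n) := by
    intro g
    have ho : IsOpen ((fun h : GL (Fin r) ℝ => g * h⁻¹) ⁻¹' V) := hV.preimage (by fun_prop)
    obtain ⟨n, hx⟩ := hu.exists_mem_open ho ⟨g, by simpa using hV1⟩
    exact ⟨n, hx⟩
  have hinj : ∀ h g, ∀ γ δ : integralGL r, γ • g ∈ W h → δ • g ∈ W h → γ = δ := by
    intro h g γ δ hγ hδ
    have := hVΓ (γ * δ⁻¹) (mul_mem γ.2 (inv_mem δ.2)) _ hγ _ hδ (by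
      simp only [Subgroup.smul_def, smul_eq_mul, InvMemClass.coe_inv]
      group)
    exact Subtype.ext (mul_inv_eq_one.mp this)
  let S : ℕ → Set (GL (Fin r) ℝ) := fun n => ⋃ γ : integralGL r, (fun g => γ • g) ⁻¹' W (u n)
  have hS : ∀ n, MeasurableSet (S n) := fun n =>
    (isOpen_iUnion fun γ : integralGL r => (hW (u n)).preimage
      (continuous_const_mul (γ : GL (Fin r) ℝ))).measurableSet
  have hSinv : ∀ n g (γ : integralGL r), γ • g ∈ S n ↔ g ∈ S n := by
    intro n g γ
    simp only [S, Set.mem_iUnion, Set.mem_preimage]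
    constructor
    · rintro ⟨δ, hδ⟩
      exact ⟨δ * γ, by rwa [mul_smul]⟩
    · rintro ⟨δ, hδ⟩
      exact ⟨δ * γ⁻¹, by rwa [mul_smul, inv_smul_smul]⟩
  refine ⟨⋃ n, W (u n) \ ⋃ m < n, S m, MeasurableSet.iUnion fun n =>
    (hW _).measurableSet.diff (MeasurableSet.iUnion fun m => MeasurableSet.iUnion fun _ => hS m),
    fun g => ?_⟩
  classical
  have hex : ∃ n, g ∈ S n := by
    obtain ⟨n, hn⟩ := hcover g
    exact ⟨n, Set.mem_iUnion.mpr ⟨1, by simpa using hn⟩⟩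
  have key : ∀ γ : integralGL r, γ • g ∈ (⋃ n, W (u n) \ ⋃ m < n, S m) ↔
      γ • g ∈ W (u (Nat.find hex)) := by
    intro γ
    simp only [Set.mem_iUnion, Set.mem_sdiff, hSinv, not_exists, exists_prop, not_and]
    constructor
    · rintro ⟨n, hn, hm⟩
      have : Nat.find hex = n := by
        rw [Nat.find_eq_iff]
        exact ⟨Set.mem_iUnion.mpr ⟨γ, hn⟩, hm⟩
      rwa [this]
    · intro h
      exact ⟨_, h, fun m hm => Nat.find_min hex hm⟩
  obtain ⟨γ, hγ⟩ := Set.mem_iUnion.mp (Nat.find_spec hex)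
  exact ⟨γ, (key γ).mpr hγ, fun δ hδ => hinj _ g _ _ ((key δ).mp hδ) hγ⟩

/-- A measurable set of representatives for `GL_r(ℤ) \ GL_r(ℝ)`. -/
def fundamentalDomain (r : ℕ) : Set (GL (Fin r) ℝ) := (exists_fundamentalDomain r).choose

namespace Moduli

variable {r : ℕ}

/-- The volume of a class of lattices. -/
def vol : Moduli r → ℝ :=
  Quotient.lift EuclideanLattice.vol fun _ _ => EuclideanLattice.vol_eq_of_isometric

/-- The Arakelov degree `deg Λ = -log Vol Λ`. -/
def deg (Λ : Moduli r) : ℝ := -Real.log Λ.vol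

/-- `h⁰(ℚ, Λ)` of a class of lattices. -/
def h0 : Moduli r → ℝ :=
  Quotient.lift EuclideanLattice.h0 fun _ _ => EuclideanLattice.h0_eq_of_isometric

/-- `Ê(Λ; s)` of a class of lattices. -/
def completedEpstein : Moduli r → ℂ → ℂ :=
  Quotient.lift EuclideanLattice.completedEpstein
    fun _ _ => EuclideanLattice.completedEpstein_eq_of_isometric

/-- `Λ ↦ (Vol Λ)^{-1/r} • Λ` on classes. -/
def normalize : Moduli r → Moduli r :=
  Quotient.map EuclideanLattice.normalize fun _ _ => EuclideanLattice.normalize_isometric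

/-- The moduli space `M_{ℚ,r}` of semistable lattices of rank `r`. -/
def semistable (r : ℕ) : Set (Moduli r) :=
  {Λ | ∃ Λ₀ : EuclideanLattice r, Λ₀.IsSemistable ∧ Quotient.mk _ Λ₀ = Λ}

/-- The moduli space `M_{ℚ,r}[T]` of semistable lattices of rank `r` and volume `T`. -/
def semistableOfVol (r : ℕ) (T : ℝ) : Set (Moduli r) :=
  {Λ | Λ ∈ semistable r ∧ Λ.vol = T}

/-- The measure `μ` on the space of lattices that is induced by a Haar measure `ν` of
`GL_r(ℝ)`: quotient by the discrete group `GL_r(ℤ)`, then image in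
`GL_r(ℤ) \ GL_r(ℝ) / O(r)`. -/
def measure (ν : Measure (GL (Fin r) ℝ)) : Measure (Moduli r) :=
  (ν.restrict (fundamentalDomain r)).map ofGL

/-- The measure `μ₁` induced by `μ` on the space of lattices of volume one, i.e. the factor `μ₁`
of `μ = (dT / T) ⊗ μ₁` under `(T, Λ) ↦ T^{1/r} • Λ`. Since `[1, e)` has mass one for `dT / T`, it is
`μ₁(A) = μ {Λ : 1 ≤ Vol Λ < e, (Vol Λ)^{-1/r} • Λ ∈ A}`. -/
def measureOne (ν : Measure (GL (Fin r) ℝ)) : Measure (Moduli r) :=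
  ((measure ν).restrict {Λ | 1 ≤ Λ.vol ∧ Λ.vol < Real.exp 1}).map normalize

end Moduli

/-- The integrand `(e^{h⁰(ℚ, Λ)} - 1) e^{-s deg Λ}`. -/
def zetaIntegrand {r : ℕ} (s : ℂ) (Λ : Moduli r) : ℂ :=
  ((Real.exp Λ.h0 - 1 : ℝ) : ℂ) * Complex.exp (-s * (Λ.deg : ℂ))

/-- The rank `r` non-abelian zeta function `ξ_{ℚ,r}(s)` of `ℚ`. -/
def nonAbelianZeta (r : ℕ) (ν : Measure (GL (Fin r) ℝ)) (s : ℂ) : ℂ :=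
  ∫ Λ in Moduli.semistable r, zetaIntegrand s Λ ∂(Moduli.measure ν)

end NonAbelianZeta

end

open MeasureTheory

open scoped Matrix Pointwise

noncomputable section

namespace NonAbelianZeta

/-! ### Covolumes and Gram determinants -/

section Gram

variable {E : Type*} [NormedAddCommGroup E] [InnerProductSpace ℝ E]

/-! The space of lattices is a union of rays of homothetic lattices, and the zeta integral is
computed ray by ray. Multiplying `Λ` by `exp (t / r)` multiplies its volume by `exp t`; the zero
vector accounts for the subtracted 1, so the integrand becomes `(Vol Λ)^s exp (s t)` times the theta
series over nonzero vectors at `u = exp (2 t / r)`. In the variable `u` the integral over `t` is `r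
/ 2` times `(Vol Λ)^s` times the Mellin transform of theta at `r s / 2`. Integrated term by term,
this transform is the completed Epstein zeta function (`mellin_theta`), and the factor `(Vol Λ)^s`
turns `Λ` into its normalization (`integral_zetaIntegrand_scale`).

Homotheties are central in `GL_r(ℝ)`, so the Haar measure modulo `GL_r(ℤ)` splits as `dt` times its
restriction to volumes in `[1, e)` (`measure_eq_map_rayPoint`). Semistability is invariant under
homothety, so the semistable locus is a union of whole rays. Both sides of the identity then become
integrals against one measure, `semistableShell`, and Fubini compares them.

Absolute convergence rests on reduction theory. A semistable lattice of volume at least 1 has no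
nonzero vector shorter than 1; with an upper bound on the volume, Minkowski's theorem gives `r`
independent vectors of bounded length. They span a sublattice of bounded index, and finitely many
classes of integer matrices lead from them to a basis in a fixed compact subset of `GL_r(ℝ)`
(`exists_smul_mem_boundedGL`). Hence `semistableShell` is finite and the Epstein zeta function is
bounded on it. Since the modulus of the integrand is the integrand at `Re s`, this also controls the
double integral. -/

theorem gram_eq_transpose_mul {ι κ : Type*} [Fintype ι] (o : OrthonormalBasis ι ℝ E)
    (v : κ → E) : Matrix.gram ℝ v = (o.toBasis.toMatrix v)ᵀ * o.toBasis.toMatrix v := by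
  ext i j
  rw [Matrix.gram_apply, Matrix.mul_apply, ← o.sum_inner_mul_inner]
  refine Finset.sum_congr rfl fun k _ => ?_
  simp [Module.Basis.toMatrix_apply, o.repr_apply_apply, real_inner_comm]

theorem det_gram_eq_sq {ι : Type*} [Fintype ι] [DecidableEq ι] (o : OrthonormalBasis ι ℝ E)
    (v : ι → E) : (Matrix.gram ℝ v).det = o.toBasis.det v ^ 2 := by
  rw [gram_eq_transpose_mul o, Matrix.det_mul, Matrix.det_transpose, Module.Basis.det_apply, sq]

theorem det_gram_ne_zero {ι : Type*} [Fintype ι] [DecidableEq ι] {v : ι → E}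
    (hv : LinearIndependent ℝ v) : (Matrix.gram ℝ v).det ≠ 0 :=
  (Matrix.posDef_gram_of_linearIndependent hv).det_pos.ne'

/-- The covolume is the absolute determinant of the lattice basis in an orthonormal basis, whose
parallelepiped has volume one; the Gram determinant is the square of that determinant. -/
theorem covolume_eq_sqrt_det_gram [FiniteDimensional ℝ E] [MeasurableSpace E] [BorelSpace E]
    (L : Submodule ℤ E) [DiscreteTopology L] [IsZLattice ℝ L] {k : ℕ}
    (b : Module.Basis (Fin k) ℤ L) :
    ZLattice.covolume L = √(Matrix.gram ℝ (fun i => (b i : E))).det := by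
  have hk : Module.finrank ℝ E = k := by
    rw [Module.finrank_eq_card_basis (b.ofZLatticeBasis ℝ L), Fintype.card_fin]
  let o : OrthonormalBasis (Fin k) ℝ E := (stdOrthonormalBasis ℝ E).reindex (finCongr hk)
  rw [ZLattice.covolume_eq_det_mul_measureReal L volume b o.toBasis, det_gram_eq_sq o,
    Real.sqrt_sq_eq_abs, measureReal_def,
    measure_congr (ZSpan.fundamentalDomain_ae_parallelepiped o.toBasis volume),
    o.coe_toBasis, o.volume_parallelepiped]
  simp [Function.comp_def]

theorem covolume_span_basis [FiniteDimensional ℝ E] [MeasurableSpace E] [BorelSpace E] {k : ℕ}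
    (b : Module.Basis (Fin k) ℝ E) :
    ZLattice.covolume (Submodule.span ℤ (Set.range b)) = √(Matrix.gram ℝ b).det := by
  rw [covolume_eq_sqrt_det_gram _ (b.restrictScalars ℤ)]
  simp

end Gram

variable {r : ℕ}

theorem comap_subtype_span_range (S : Submodule ℝ (EuclideanSpace ℝ (Fin r))) {ι : Type*}
    (c : ι → S) :
    ZLattice.comap ℝ (Submodule.span ℤ (Set.range fun i => (c i : EuclideanSpace ℝ (Fin r))))
      S.subtype = Submodule.span ℤ (Set.range c) := by
  have h : (Set.range fun i => (c i : EuclideanSpace ℝ (Fin r))) =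
      (S.subtype.restrictScalars ℤ) '' Set.range c := by
    rw [← Set.range_comp]; rfl
  rw [h, ← Submodule.map_span, ZLattice.comap]
  exact Submodule.comap_map_eq_of_injective (f := S.subtype.restrictScalars ℤ)
    S.injective_subtype _

theorem covolumeIn_span_basis (S : Submodule ℝ (EuclideanSpace ℝ (Fin r))) {k : ℕ}
    (c : Module.Basis (Fin k) ℝ S) :
    covolumeIn S (Submodule.span ℤ (Set.range fun i => (c i : EuclideanSpace ℝ (Fin r)))) =
      √(Matrix.gram ℝ fun i => (c i : EuclideanSpace ℝ (Fin r))).det := by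
  rw [covolumeIn, comap_subtype_span_range, OrthonormalBasis.addHaar_eq_volume,
    covolume_span_basis]
  rfl

/-- The volume of the sublattice generated by linearly independent vectors is the square root of
their Gram determinant. -/
theorem sublatticeVol_span {k : ℕ} (v : Fin k → EuclideanSpace ℝ (Fin r))
    (hv : LinearIndependent ℝ v) :
    sublatticeVol (Submodule.span ℤ (Set.range v)) = √(Matrix.gram ℝ v).det := by
  rw [sublatticeVol, Submodule.span_span_of_tower]
  have h : v = fun i => (Module.Basis.span hv i : EuclideanSpace ℝ (Fin r)) := by
    ext1 i; rw [Module.Basis.span_apply]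
  have := covolumeIn_span_basis _ (Module.Basis.span hv)
  rwa [← h] at this

/-- Inside its own real span a discrete subgroup is a full lattice, and a `ℤ`-basis of a full
lattice is an `ℝ`-basis of the space. -/
theorem exists_linearIndependent_span_eq (L : Submodule ℤ (EuclideanSpace ℝ (Fin r)))
    [DiscreteTopology L] :
    ∃ (k : ℕ) (v : Fin k → EuclideanSpace ℝ (Fin r)), LinearIndependent ℝ v ∧
      Submodule.span ℤ (Set.range v) = L := by
  let S := Submodule.span ℝ (L : Set (EuclideanSpace ℝ (Fin r)))
  let L' := ZLattice.comap ℝ L S.subtype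
  have hd : DiscreteTopology L' :=
    ZLattice.comap_discreteTopology ℝ L (by fun_prop) S.injective_subtype
  have hz : IsZLattice ℝ L' := ⟨by
    rw [ZLattice.coe_comap]
    exact Submodule.span_span_coe_preimage⟩
  have hf : Module.Finite ℤ L' := ZLattice.module_finite ℝ L'
  have hfr : Module.Free ℤ L' := ZLattice.module_free ℝ L'
  let b := (Module.finBasis ℤ L').ofZLatticeBasis ℝ L'
  have hb : Submodule.span ℤ (Set.range b) = L' :=
    (Module.finBasis ℤ L').ofZLatticeBasis_span ℝ
  refine ⟨_, fun i => b i, b.linearIndependent.map' S.subtype (Submodule.ker_subtype S), ?_⟩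
  have h : (Set.range fun i => (b i : EuclideanSpace ℝ (Fin r))) =
      (S.subtype.restrictScalars ℤ) '' Set.range b := by
    rw [← Set.range_comp]; rfl
  rw [h, ← Submodule.map_span, hb]
  refine Submodule.map_comap_eq_self ?_
  intro x hx
  exact ⟨⟨x, Submodule.subset_span hx⟩, rfl⟩

/-! ### Semistability through Gram determinants -/

namespace EuclideanLattice

theorem finrank_carrier (Λ : EuclideanLattice r) : Module.finrank ℤ Λ.carrier = r := by
  rw [ZLattice.rank ℝ, finrank_euclideanSpace_fin]

/-- Quantifying over tuples of vectors instead of subgroups gives explicit inequalities, whose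
behaviour under isometries and homotheties is visible and which are countable in number once a basis
is chosen. -/
theorem isSemistable_iff (Λ : EuclideanLattice r) : Λ.IsSemistable ↔
    ∀ (k : ℕ) (v : Fin k → EuclideanSpace ℝ (Fin r)), (∀ i, v i ∈ Λ.carrier) →
      (Matrix.gram ℝ v).det ≠ 0 → Λ.vol ^ k ≤ √(Matrix.gram ℝ v).det ^ r := by
  have key : ∀ (k : ℕ) (v : Fin k → EuclideanSpace ℝ (Fin r)), LinearIndependent ℝ v →
      Module.finrank ℤ (Submodule.span ℤ (Set.range v)) = k := by
    intro k v hv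
    have h : LinearIndependent ℤ v := hv.restrict_scalars
      (by simpa using Int.cast_injective)
    rw [finrank_span_eq_card h, Fintype.card_fin]
  rw [IsSemistable, finrank_carrier]
  constructor
  · intro h k v hv hdet
    have hli := Matrix.linearIndependent_of_det_gram_ne_zero hdet
    have := h (Submodule.span ℤ (Set.range v))
      (Submodule.span_le.mpr (by rintro _ ⟨i, rfl⟩; exact hv i))
    rwa [key k v hli, sublatticeVol_span v hli] at this
  · intro h L hL
    have hd : DiscreteTopology L :=
      DiscreteTopology.of_subset (s := (Λ.carrier : Set _)) Λ.discrete hL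
    obtain ⟨k, v, hv, rfl⟩ := exists_linearIndependent_span_eq L
    rw [key k v hv, sublatticeVol_span v hv]
    exact h k v (fun i => hL (Submodule.subset_span ⟨i, rfl⟩)) (det_gram_ne_zero hv)

theorem gram_isometry (φ : EuclideanSpace ℝ (Fin r) ≃ₗᵢ[ℝ] EuclideanSpace ℝ (Fin r)) {k : ℕ}
    (v : Fin k → EuclideanSpace ℝ (Fin r)) :
    Matrix.gram ℝ (fun i => φ (v i)) = Matrix.gram ℝ v := by
  ext i j
  simp

theorem IsSemistable.of_isometric {Λ Λ' : EuclideanLattice r} (h : Isometric Λ Λ')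
    (hΛ : Λ.IsSemistable) : Λ'.IsSemistable := by
  rw [isSemistable_iff] at hΛ ⊢
  rw [← vol_eq_of_isometric h]
  obtain ⟨φ, rfl⟩ := h
  intro k v hv hdet
  have := hΛ k (fun i => φ.symm (v i)) (fun i => hv i)
  rw [gram_isometry φ.symm] at this
  exact this hdet

theorem mem_scale {t : ℝˣ} {Λ : EuclideanLattice r} {x : EuclideanSpace ℝ (Fin r)} :
    x ∈ (scale t Λ).carrier ↔ (t : ℝ)⁻¹ • x ∈ Λ.carrier := by
  rw [scale, mem_map]
  have : (ContinuousLinearEquiv.smulLeft (R₁ := ℝ) (M₁ := EuclideanSpace ℝ (Fin r)) t).symm x =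
      (t : ℝ)⁻¹ • x := by
    rw [ContinuousLinearEquiv.symm_apply_eq]
    change x = t • ((t : ℝ)⁻¹ • x)
    rw [Units.smul_def, smul_smul, mul_inv_cancel₀ t.ne_zero, one_smul]
  rw [this]

theorem det_gram_smul (a : ℝ) {k : ℕ} (v : Fin k → EuclideanSpace ℝ (Fin r)) :
    (Matrix.gram ℝ (fun i => a • v i)).det = (a ^ k) ^ 2 * (Matrix.gram ℝ v).det := by
  have : Matrix.gram ℝ (fun i => a • v i) = (a ^ 2) • Matrix.gram ℝ v := by
    ext i j
    simp [inner_smul_left, inner_smul_right]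
    ring
  rw [this, Matrix.det_smul, Fintype.card_fin]
  ring

theorem vol_scale (t : ℝˣ) (Λ : EuclideanLattice r) : (scale t Λ).vol = |(t : ℝ)| ^ r * Λ.vol := by
  have hf : Module.Finite ℤ Λ.carrier := ZLattice.module_finite ℝ Λ.carrier
  have hfr : Module.Free ℤ Λ.carrier := ZLattice.module_free ℝ Λ.carrier
  let b : Module.Basis (Fin r) ℤ Λ.carrier := Module.finBasisOfFinrankEq ℤ _ Λ.finrank_carrier
  let e := ContinuousLinearEquiv.smulLeft (R₁ := ℝ) (M₁ := EuclideanSpace ℝ (Fin r)) t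
  let b' : Module.Basis (Fin r) ℤ (scale t Λ).carrier :=
    b.ofZLatticeComap ℝ Λ.carrier e.symm.toLinearEquiv
  have hb' : (fun i => (b' i : EuclideanSpace ℝ (Fin r))) =
      fun i => (t : ℝ) • (b i : EuclideanSpace ℝ (Fin r)) := by
    funext i
    rfl
  rw [vol, vol, covolume_eq_sqrt_det_gram _ b', covolume_eq_sqrt_det_gram _ b, hb', det_gram_smul,
    Real.sqrt_mul (sq_nonneg _), Real.sqrt_sq_eq_abs, abs_pow]

/-- For a sublattice of rank `k`, both sides of the inequality are multiplied by `|t| ^ (r * k)`. -/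
theorem IsSemistable.scale {Λ : EuclideanLattice r} (hΛ : Λ.IsSemistable) (t : ℝˣ) :
    (EuclideanLattice.scale t Λ).IsSemistable := by
  rw [isSemistable_iff] at hΛ ⊢
  intro k v hv hdet
  have h := hΛ k (fun i => (t : ℝ)⁻¹ • v i) (fun i => mem_scale.mp (hv i))
    (by rw [det_gram_smul]; exact mul_ne_zero (by simp) hdet)
  rw [det_gram_smul, Real.sqrt_mul (sq_nonneg _), Real.sqrt_sq_eq_abs, mul_pow, abs_pow, abs_inv]
    at h
  rw [vol_scale, mul_pow]
  have ht : 0 < |(t : ℝ)| := abs_pos.mpr t.ne_zero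
  calc (|(t : ℝ)| ^ r) ^ k * Λ.vol ^ k
      ≤ (|(t : ℝ)| ^ r) ^ k * (((|(t : ℝ)|⁻¹ ^ k) ^ r) * √(Matrix.gram ℝ v).det ^ r) := by gcongr
    _ = √(Matrix.gram ℝ v).det ^ r := by
      rw [← mul_assoc, ← pow_mul, ← pow_mul, mul_comm k r, ← mul_pow, mul_inv_cancel₀ ht.ne',
        one_pow, one_mul]

theorem mem_ofGL (g : GL (Fin r) ℝ) {x : EuclideanSpace ℝ (Fin r)} :
    x ∈ (ofGL g).carrier ↔ ∃ n : Fin r → ℤ,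
      WithLp.toLp 2 ((fun i => (n i : ℝ)) ᵥ* (g : Matrix (Fin r) (Fin r) ℝ)) = x := by
  change x ∈ Submodule.span ℤ _ ↔ _
  rw [Submodule.mem_span_range_iff_exists_fun]
  refine exists_congr fun n => ?_
  have : ∑ i, n i • WithLp.toLp 2 ((g : Matrix (Fin r) (Fin r) ℝ) i) =
      WithLp.toLp 2 ((fun i => (n i : ℝ)) ᵥ* (g : Matrix (Fin r) (Fin r) ℝ)) := by
    ext j
    simp [Matrix.vecMul, dotProduct]
  rw [this]

theorem vol_ofGL (g : GL (Fin r) ℝ) : (ofGL g).vol = |(g : Matrix (Fin r) (Fin r) ℝ).det| := by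
  obtain ⟨b, hb⟩ := exists_rowBasis g
  have h : (ofGL g).vol = ZLattice.covolume (Submodule.span ℤ (Set.range b)) := by
    rw [hb]; rfl
  rw [h, covolume_span_basis, hb, det_gram_eq_sq (EuclideanSpace.basisFun (Fin r) ℝ),
    Real.sqrt_sq_eq_abs, Module.Basis.det_apply, ← Matrix.det_transpose]
  congr 2

end EuclideanLattice

/-! ### Theta and Epstein series -/

namespace EuclideanLattice

/-- One term of the exponential series bounds the Gaussian by a multiple of `‖x‖ ^ (-2 * (r + 1))`,
an exponent large enough for summation over a lattice of rank `r`. -/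
theorem summable_gaussian (Λ : EuclideanLattice r) {c : ℝ} (hc : 0 < c) :
    Summable fun x : Λ.carrier => Real.exp (-c * ‖x‖ ^ 2) := by
  have h1 : Summable fun x : Λ.carrier =>
      ((r + 1).factorial / c ^ (r + 1)) * ‖x‖⁻¹ ^ (2 * (r + 1)) :=
    (ZLattice.summable_norm_pow_inv Λ.carrier (2 * (r + 1))
      (by rw [finrank_carrier]; omega)).mul_left _
  refine h1.of_norm_bounded_eventually ?_
  have h0 : ({0}ᶜ : Set Λ.carrier) ∈ Filter.cofinite := by simp
  filter_upwards [h0] with x hx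
  have hx0 : 0 < ‖x‖ := norm_pos_iff.mpr hx
  have hy : 0 < c * ‖x‖ ^ 2 := by positivity
  have h2 := Real.pow_div_factorial_le_exp (c * ‖x‖ ^ 2) hy.le (r + 1)
  rw [Real.norm_eq_abs, abs_of_pos (Real.exp_pos _), neg_mul, Real.exp_neg]
  calc (Real.exp (c * ‖x‖ ^ 2))⁻¹ ≤ ((c * ‖x‖ ^ 2) ^ (r + 1) / (r + 1).factorial)⁻¹ := by
        gcongr
    _ = ((r + 1).factorial / c ^ (r + 1)) * ‖x‖⁻¹ ^ (2 * (r + 1)) := by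
        rw [inv_div, mul_pow, ← pow_mul, inv_pow]
        field_simp

theorem summable_norm_rpow_ne_zero (Λ : EuclideanLattice r) {p : ℝ} (hp : p < -r) :
    Summable fun x : {x : Λ.carrier // x ≠ 0} => ‖(x : Λ.carrier)‖ ^ p :=
  (ZLattice.summable_norm_rpow Λ.carrier p (by rwa [finrank_carrier])).subtype _

theorem norm_cpow_neg_two_mul {Λ : EuclideanLattice r} (x : {x : Λ.carrier // x ≠ 0}) (s : ℂ) :
    ‖(‖(x : Λ.carrier)‖ : ℂ) ^ (-2 * s)‖ = ‖(x : Λ.carrier)‖ ^ (-2 * s.re) := by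
  rw [Complex.norm_cpow_eq_rpow_re_of_pos (norm_pos_iff.mpr x.2)]
  simp

theorem summable_epstein (Λ : EuclideanLattice r) {s : ℂ} (hs : (r : ℝ) / 2 < s.re) :
    Summable fun x : {x : Λ.carrier // x ≠ 0} => (‖(x : Λ.carrier)‖ : ℂ) ^ (-2 * s) := by
  refine Summable.of_norm ?_
  simp only [norm_cpow_neg_two_mul]
  exact Λ.summable_norm_rpow_ne_zero (by linarith)

/-- The sum of `exp (-π t |x|²)` over the nonzero vectors of `Λ`. -/
def theta (Λ : EuclideanLattice r) (t : ℝ) : ℝ :=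
  ∑' x : {x : Λ.carrier // x ≠ 0}, Real.exp (-Real.pi * ‖(x : Λ.carrier)‖ ^ 2 * t)

theorem summable_theta (Λ : EuclideanLattice r) {t : ℝ} (ht : 0 < t) :
    Summable fun x : {x : Λ.carrier // x ≠ 0} =>
      Real.exp (-Real.pi * ‖(x : Λ.carrier)‖ ^ 2 * t) := by
  refine ((Λ.summable_gaussian (mul_pos Real.pi_pos ht)).subtype ({0}ᶜ : Set Λ.carrier)).congr
    fun x => ?_
  simp only [Function.comp_apply]
  congr 1
  ring

theorem theta_nonneg (Λ : EuclideanLattice r) (t : ℝ) : 0 ≤ Λ.theta t :=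
  tsum_nonneg fun _ => (Real.exp_pos _).le

theorem tsum_eq_one_add_theta (Λ : EuclideanLattice r) {t : ℝ} (ht : 0 < t) :
    ∑' x : Λ.carrier, Real.exp (-Real.pi * ‖x‖ ^ 2 * t) = 1 + Λ.theta t := by
  have h : Summable fun x : Λ.carrier => Real.exp (-Real.pi * ‖x‖ ^ 2 * t) := by
    refine (Λ.summable_gaussian (mul_pos Real.pi_pos ht)).congr fun x => ?_
    congr 1
    ring
  rw [← (h.subtype ({0} : Set Λ.carrier)).tsum_add_tsum_compl (h.subtype _)]
  congr 1
  refine (tsum_singleton (0 : Λ.carrier) fun x => Real.exp (-Real.pi * ‖x‖ ^ 2 * t)).trans ?_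
  simp

theorem exp_h0 (Λ : EuclideanLattice r) : Real.exp Λ.h0 = 1 + Λ.theta 1 := by
  have h := Λ.tsum_eq_one_add_theta one_pos
  simp only [mul_one] at h
  rw [h0, h, Real.exp_log (by linarith [Λ.theta_nonneg 1])]

/-- Multiplication by `t` as a bijection from `Λ` to `t • Λ`. -/
def scaleEquiv (t : ℝˣ) (Λ : EuclideanLattice r) : Λ.carrier ≃ (scale t Λ).carrier where
  toFun x := ⟨(t : ℝ) • x, by
    rw [mem_scale, smul_smul, inv_mul_cancel₀ t.ne_zero, one_smul]
    exact x.2⟩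
  invFun x := ⟨(t : ℝ)⁻¹ • x, mem_scale.mp x.2⟩
  left_inv x := by ext1; simp [smul_smul]
  right_inv x := by ext1; simp [smul_smul]

theorem norm_scaleEquiv (t : ℝˣ) (Λ : EuclideanLattice r) (x : Λ.carrier) :
    ‖scaleEquiv t Λ x‖ = |(t : ℝ)| * ‖x‖ :=
  norm_smul (t : ℝ) (x : EuclideanSpace ℝ (Fin r))

/-- Multiplication by `t` as a bijection between nonzero vectors. -/
def scaleEquivNeZero (t : ℝˣ) (Λ : EuclideanLattice r) :
    {x : Λ.carrier // x ≠ 0} ≃ {x : (scale t Λ).carrier // x ≠ 0} :=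
  (scaleEquiv t Λ).subtypeEquiv fun x => by
    rw [← norm_ne_zero_iff, ← norm_ne_zero_iff (a := scaleEquiv t Λ x), norm_scaleEquiv]
    simp

theorem norm_scaleEquivNeZero (t : ℝˣ) (Λ : EuclideanLattice r) (x : {x : Λ.carrier // x ≠ 0}) :
    ‖(scaleEquivNeZero t Λ x : (scale t Λ).carrier)‖ = |(t : ℝ)| * ‖(x : Λ.carrier)‖ :=
  norm_scaleEquiv t Λ x

theorem theta_scale (t : ℝˣ) (Λ : EuclideanLattice r) (u : ℝ) :
    (scale t Λ).theta u = Λ.theta ((t : ℝ) ^ 2 * u) := by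
  rw [theta, theta, ← (scaleEquivNeZero t Λ).tsum_eq]
  refine tsum_congr fun x => ?_
  rw [norm_scaleEquivNeZero, mul_pow, sq_abs]
  congr 1
  ring

theorem completedEpstein_scale {t : ℝˣ} (ht : 0 < (t : ℝ)) (Λ : EuclideanLattice r) (s : ℂ) :
    (scale t Λ).completedEpstein s = (t : ℂ) ^ (-2 * s) * Λ.completedEpstein s := by
  rw [completedEpstein, completedEpstein, ← (scaleEquivNeZero t Λ).tsum_eq, mul_left_comm
    ((t : ℂ) ^ (-2 * s)), ← tsum_mul_left (a := (t : ℂ) ^ (-2 * s))]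
  congr 1
  refine tsum_congr fun x => ?_
  rw [norm_scaleEquivNeZero, abs_of_pos ht, Complex.ofReal_mul,
    Complex.mul_cpow_ofReal_nonneg ht.le (norm_nonneg _)]

theorem completedEpstein_normalize (hr : 0 < r) (Λ : EuclideanLattice r) (s : ℂ) :
    Λ.normalize.completedEpstein ((r : ℂ) / 2 * s) =
      (Λ.vol : ℂ) ^ s * Λ.completedEpstein ((r : ℂ) / 2 * s) := by
  rw [normalize, completedEpstein_scale (Real.rpow_pos_of_pos Λ.vol_pos _)]
  congr 1
  have hr' : (r : ℂ) ≠ 0 := by exact_mod_cast hr.ne'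
  have hv : (Λ.vol : ℂ) ≠ 0 := by exact_mod_cast Λ.vol_pos.ne'
  rw [Units.val_mk0, Complex.cpow_def_of_ne_zero hv,
    Complex.cpow_def_of_ne_zero (by exact_mod_cast (Real.rpow_pos_of_pos Λ.vol_pos _).ne'),
    ← Complex.ofReal_log (Real.rpow_pos_of_pos Λ.vol_pos _).le, Real.log_rpow Λ.vol_pos,
    ← Complex.ofReal_log Λ.vol_pos.le]
  congr 1
  push_cast
  field_simp

/-- Termwise integration: each nonzero vector contributes a Gamma integral, and the interchange is
justified by the absolute convergence of the Epstein series. -/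
theorem mellin_theta (hr : 0 < r) (Λ : EuclideanLattice r) {s : ℂ} (hs : (r : ℝ) / 2 < s.re) :
    mellin (fun t => (Λ.theta t : ℂ)) s = Λ.completedEpstein s := by
  have hs0 : 0 < s.re := lt_trans (by positivity) hs
  have h := hasSum_mellin_pi_mul (ι := {x : Λ.carrier // x ≠ 0}) (a := fun _ => 1)
    (q := fun x => ‖(x : Λ.carrier)‖ ^ 2) (F := fun t => (Λ.theta t : ℂ)) (s := s)
    (fun x => Or.inr (pow_pos (norm_pos_iff.mpr x.2) 2)) hs0
    (fun t ht => by
      simp only [one_mul]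
      exact_mod_cast (Λ.summable_theta ht).hasSum)
    (by
      refine (Λ.summable_norm_rpow_ne_zero (p := -2 * s.re) (by linarith)).congr fun x => ?_
      rw [norm_one, ← Real.rpow_natCast, ← Real.rpow_mul (norm_nonneg _), one_div,
        ← Real.rpow_neg (norm_nonneg _)]
      congr 1
      push_cast
      ring)
  rw [← h.tsum_eq, completedEpstein, ← tsum_mul_left]
  refine tsum_congr fun x => ?_
  have hx : 0 < ‖(x : Λ.carrier)‖ := norm_pos_iff.mpr x.2
  rw [mul_one, div_eq_mul_inv, ← Complex.cpow_neg, sq, Complex.ofReal_mul,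
    Complex.mul_cpow_ofReal_nonneg hx.le hx.le, ← Complex.cpow_add _ _ (by exact_mod_cast hx.ne')]
  congr 2
  ring

theorem exists_mem_ne_zero (hr : 0 < r) (Λ : EuclideanLattice r) :
    Nonempty {x : Λ.carrier // x ≠ 0} := by
  have : Nontrivial Λ.carrier := by
    have hf : Module.Finite ℤ Λ.carrier := ZLattice.module_finite ℝ Λ.carrier
    have hfr : Module.Free ℤ Λ.carrier := ZLattice.module_free ℝ Λ.carrier
    exact Module.nontrivial_of_finrank_pos (R := ℤ) (by rwa [finrank_carrier])
  obtain ⟨x, hx⟩ := exists_ne (0 : Λ.carrier)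
  exact ⟨⟨x, hx⟩⟩

/-- At a real point every factor and every term is positive. Nonvanishing is what
`mellinConvergent_theta` needs. -/
theorem completedEpstein_ofReal_ne_zero (hr : 0 < r) (Λ : EuclideanLattice r) {σ : ℝ}
    (hσ : (r : ℝ) / 2 < σ) : Λ.completedEpstein σ ≠ 0 := by
  have hσ0 : 0 < σ := lt_trans (by positivity) hσ
  have h : ∑' x : {x : Λ.carrier // x ≠ 0}, (‖(x : Λ.carrier)‖ : ℂ) ^ (-2 * (σ : ℂ)) =
      ((∑' x : {x : Λ.carrier // x ≠ 0}, ‖(x : Λ.carrier)‖ ^ (-2 * σ) : ℝ) : ℂ) := by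
    rw [Complex.ofReal_tsum]
    refine tsum_congr fun x => ?_
    rw [Complex.ofReal_cpow (norm_nonneg _)]
    push_cast
    rfl
  rw [completedEpstein, h]
  refine mul_ne_zero (mul_ne_zero ?_ (Complex.Gamma_ne_zero_of_re_pos (by simpa))) ?_
  · rw [Complex.cpow_def_of_ne_zero (by exact_mod_cast Real.pi_ne_zero)]
    exact Complex.exp_ne_zero _
  · obtain ⟨x⟩ := Λ.exists_mem_ne_zero hr
    exact_mod_cast ((Λ.summable_norm_rpow_ne_zero (p := -2 * σ) (by linarith)).tsum_pos
      (fun y => by positivity) x (Real.rpow_pos_of_pos (norm_pos_iff.mpr x.2) _)).ne'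

theorem measurable_theta (Λ : EuclideanLattice r) : Measurable Λ.theta := by
  refine Measurable.tsum fun x => ?_
  fun_prop

theorem mellinConvergent_theta (hr : 0 < r) (Λ : EuclideanLattice r) {s : ℂ}
    (hs : (r : ℝ) / 2 < s.re) : MellinConvergent (fun t => (Λ.theta t : ℂ)) s := by
  have h1 : MellinConvergent (fun t => (Λ.theta t : ℂ)) (s.re : ℂ) := by
    -- The Bochner integral of a non-integrable function is 0 by convention, so the nonzero value at
    -- the real point `s.re` forces integrability there.
    refine Integrable.of_integral_ne_zero ?_
    have := Λ.completedEpstein_ofReal_ne_zero hr hs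
    rwa [← Λ.mellin_theta hr (by simpa using hs), mellin] at this
  have hm : AEStronglyMeasurable (fun t => (Λ.theta t : ℂ)) (volume.restrict (Set.Ioi 0)) :=
    (Complex.measurable_ofReal.comp Λ.measurable_theta).aestronglyMeasurable
  rw [MellinConvergent, mellin_convergent_iff_norm (Set.Subset.refl _) measurableSet_Ioi hm] at h1 ⊢
  simpa using h1

end EuclideanLattice

/-! ### The integral along a ray of homothetic lattices -/

/-- The class of a lattice. -/
def Moduli.mk (Λ : EuclideanLattice r) : Moduli r := Quotient.mk _ Λ

theorem zetaIntegrand_mk (s : ℂ) (Λ : EuclideanLattice r) :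
    zetaIntegrand s (Moduli.mk Λ) = (Λ.theta 1 : ℂ) * Complex.exp (s * Real.log Λ.vol) := by
  have h1 : Moduli.h0 (Moduli.mk Λ) = Λ.h0 := rfl
  have h2 : Moduli.deg (Moduli.mk Λ) = -Real.log Λ.vol := rfl
  rw [zetaIntegrand, h1, h2, Λ.exp_h0, add_sub_cancel_left]
  congr 2
  push_cast
  ring

/-- The theta factor is nonnegative and the modulus of the exponential depends only on `s.re`. This
reduces absolute convergence to the case of real `s`. -/
theorem norm_zetaIntegrand (s : ℂ) (Λ : Moduli r) :
    (‖zetaIntegrand s Λ‖ : ℂ) = zetaIntegrand (s.re : ℂ) Λ := by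
  obtain ⟨Λ, rfl⟩ : ∃ Λ' : EuclideanLattice r, Moduli.mk Λ' = Λ := Quotient.exists_rep Λ
  rw [zetaIntegrand_mk, zetaIntegrand_mk, norm_mul, Complex.norm_exp, Complex.norm_real,
    Real.norm_of_nonneg (Λ.theta_nonneg 1)]
  simp

/-- The homothety of ratio `exp (t / r)`, which multiplies volumes by `exp t`. -/
def expUnit (r : ℕ) (t : ℝ) : ℝˣ := Units.mk0 (Real.exp (t / r)) (Real.exp_ne_zero _)

theorem expUnit_pos (t : ℝ) : 0 < (expUnit r t : ℝ) := Real.exp_pos _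

theorem expUnit_pow (hr : 0 < r) (t : ℝ) : (expUnit r t : ℝ) ^ r = Real.exp t := by
  have : (r : ℝ) ≠ 0 := by exact_mod_cast hr.ne'
  rw [expUnit, Units.val_mk0, ← Real.exp_nat_mul]
  congr 1
  field_simp

namespace EuclideanLattice

theorem vol_scale_expUnit (hr : 0 < r) (Λ : EuclideanLattice r) (t : ℝ) :
    (scale (expUnit r t) Λ).vol = Real.exp t * Λ.vol := by
  rw [vol_scale, abs_of_pos (expUnit_pos t), expUnit_pow hr]

/-- With `u = exp (2 t / r)` one has `exp (s t) = u ^ (r s / 2)` and `du = (2 / r) u dt`. The right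
side is arranged as the absolute derivative of `u` times the Mellin integrand, ready for the change
of variables. -/
theorem zetaIntegrand_scale_expUnit (hr : 0 < r) (s : ℂ) (Λ : EuclideanLattice r) (t : ℝ) :
    zetaIntegrand s (Moduli.mk (scale (expUnit r t) Λ)) =
      ((r : ℂ) / 2 * (Λ.vol : ℂ) ^ s) * (|2 / r * Real.exp (2 / r * t)| •
        ((Real.exp (2 / r * t) : ℂ) ^ ((r : ℂ) / 2 * s - 1) •
          (Λ.theta (Real.exp (2 / r * t)) : ℂ))) := by
  have hr' : (r : ℂ) ≠ 0 := by exact_mod_cast hr.ne'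
  have hr0 : 0 < (r : ℝ) := by exact_mod_cast hr
  have hv : (Λ.vol : ℂ) ≠ 0 := by exact_mod_cast Λ.vol_pos.ne'
  have h1 : (expUnit r t : ℝ) ^ 2 * 1 = Real.exp (2 / r * t) := by
    rw [expUnit, Units.val_mk0, ← Real.exp_nat_mul, mul_one]
    congr 1
    push_cast
    ring
  rw [zetaIntegrand_mk, theta_scale, h1, vol_scale_expUnit hr, abs_of_pos (by positivity),
    Real.log_mul (Real.exp_ne_zero _) Λ.vol_pos.ne', Real.log_exp,
    Complex.cpow_def_of_ne_zero hv, ← Complex.ofReal_log Λ.vol_pos.le,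
    Complex.cpow_def_of_ne_zero (by exact_mod_cast Real.exp_ne_zero _),
    ← Complex.ofReal_log (Real.exp_pos _).le, Real.log_exp, Complex.real_smul, smul_eq_mul]
  have h2 : Complex.exp (s * ((t + Real.log Λ.vol : ℝ) : ℂ)) =
      Complex.exp (Real.log Λ.vol * s) * (Complex.exp ((2 / r * t : ℝ) : ℂ) *
        Complex.exp (((2 / r * t : ℝ) : ℂ) * ((r : ℂ) / 2 * s - 1))) := by
    rw [← Complex.exp_add, ← Complex.exp_add]
    congr 1
    push_cast
    field_simp
    ring
  rw [h2]
  push_cast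
  field_simp

theorem image_exp_mul (hr : 0 < r) :
    (fun t : ℝ => Real.exp (2 / r * t)) '' Set.univ = Set.Ioi 0 := by
  have hr0 : (r : ℝ) ≠ 0 := by exact_mod_cast hr.ne'
  ext x
  simp only [Set.image_univ, Set.mem_range, Set.mem_Ioi]
  refine ⟨?_, fun hx => ⟨r / 2 * Real.log x, ?_⟩⟩
  · rintro ⟨t, rfl⟩
    exact Real.exp_pos _
  · rw [← mul_assoc, div_mul_div_cancel₀ hr0, div_self two_ne_zero, one_mul, Real.exp_log hx]

theorem hasDerivAt_exp_mul (a t : ℝ) :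
    HasDerivAt (fun t : ℝ => Real.exp (a * t)) (a * Real.exp (a * t)) t := by
  have := ((hasDerivAt_id t).const_mul a).exp
  simpa [mul_comm] using this

theorem injective_exp_mul (hr : 0 < r) : Function.Injective fun t : ℝ => Real.exp (2 / r * t) := by
  have hr0 : (2 / r : ℝ) ≠ 0 := by positivity
  intro x y h
  exact mul_left_cancel₀ hr0 (Real.exp_injective h)

variable {s : ℂ}

theorem half_lt_re (hr : 0 < r) (hs : 1 < s.re) : (r : ℝ) / 2 < ((r : ℂ) / 2 * s).re := by
  have hr0 : 0 < (r : ℝ) := by exact_mod_cast hr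
  have : ((r : ℂ) / 2 * s).re = r / 2 * s.re := by
    rw [show (r : ℂ) / 2 = ((r / 2 : ℝ) : ℂ) by push_cast; rfl, Complex.re_ofReal_mul]
  rw [this]
  nlinarith

theorem integrable_zetaIntegrand_scale (hr : 0 < r) (hs : 1 < s.re) (Λ : EuclideanLattice r) :
    Integrable fun t => zetaIntegrand s (Moduli.mk (scale (expUnit r t) Λ)) := by
  simp only [zetaIntegrand_scale_expUnit hr]
  refine Integrable.const_mul ?_ _
  have := integrableOn_image_iff_integrableOn_abs_deriv_smul MeasurableSet.univ
    (fun x _ => (hasDerivAt_exp_mul (2 / r) x).hasDerivWithinAt) (injective_exp_mul hr).injOn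
    (fun u : ℝ => (u : ℂ) ^ ((r : ℂ) / 2 * s - 1) • (Λ.theta u : ℂ))
  rw [image_exp_mul hr, integrableOn_univ] at this
  exact this.mp (Λ.mellinConvergent_theta hr (half_lt_re hr hs))

theorem integral_zetaIntegrand_scale (hr : 0 < r) (hs : 1 < s.re) (Λ : EuclideanLattice r) :
    ∫ t, zetaIntegrand s (Moduli.mk (scale (expUnit r t) Λ)) =
      (r : ℂ) / 2 * Λ.normalize.completedEpstein ((r : ℂ) / 2 * s) := by
  simp only [zetaIntegrand_scale_expUnit hr]
  rw [integral_const_mul, completedEpstein_normalize hr, ← mul_assoc,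
    ← Λ.mellin_theta hr (half_lt_re hr hs), mellin, ← image_exp_mul hr,
    integral_image_eq_integral_abs_deriv_smul MeasurableSet.univ
      (fun x _ => (hasDerivAt_exp_mul (2 / r) x).hasDerivWithinAt) (injective_exp_mul hr).injOn,
    setIntegral_univ]

theorem integral_norm_zetaIntegrand_scale (hr : 0 < r) (hs : 1 < s.re) (Λ : EuclideanLattice r) :
    ∫ t, ‖zetaIntegrand s (Moduli.mk (scale (expUnit r t) Λ))‖ =
      ‖(r : ℂ) / 2 * Λ.normalize.completedEpstein ((r : ℂ) / 2 * s.re)‖ := by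
  rw [← integral_zetaIntegrand_scale hr (by simpa using hs)]
  simp only [← norm_zetaIntegrand]
  rw [integral_complex_ofReal, Complex.norm_real,
    Real.norm_of_nonneg (integral_nonneg fun _ => norm_nonneg _)]

end EuclideanLattice

/-! ### Reduction theory of semistable lattices -/

theorem norm_le_sum_abs {E ι : Type*} [NormedAddCommGroup E] [InnerProductSpace ℝ E] [Fintype ι]
    (o : OrthonormalBasis ι ℝ E) (x : E) : ‖x‖ ≤ ∑ i, |inner ℝ (o i) x| := by
  conv_lhs => rw [← o.sum_repr' x]
  refine (norm_sum_le _ _).trans (le_of_eq (Finset.sum_congr rfl fun i _ => ?_))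
  rw [norm_smul, o.norm_eq_one, mul_one, Real.norm_eq_abs]

/-- The open box with half sides `a i` in the directions of an orthonormal basis. -/
def orthoBox {E ι : Type*} [NormedAddCommGroup E] [InnerProductSpace ℝ E] [Fintype ι]
    (o : OrthonormalBasis ι ℝ E) (a : ι → ℝ) : Set E := {x | ∀ i, |inner ℝ (o i) x| < a i}

theorem convex_orthoBox {E ι : Type*} [NormedAddCommGroup E] [InnerProductSpace ℝ E] [Fintype ι]
    (o : OrthonormalBasis ι ℝ E) (a : ι → ℝ) : Convex ℝ (orthoBox o a) := by
  intro x hx y hy s t hs ht hst i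
  rw [inner_add_right, inner_smul_right, inner_smul_right]
  have h1 := abs_lt.mp (hx i)
  have h2 := abs_lt.mp (hy i)
  have := (convex_Ioo (-a i) (a i)) (Set.mem_Ioo.mpr h1) (Set.mem_Ioo.mpr h2) hs ht hst
  exact abs_lt.mpr this

theorem volume_orthoBox {E ι : Type*} [NormedAddCommGroup E] [InnerProductSpace ℝ E] [Fintype ι]
    [FiniteDimensional ℝ E] [MeasurableSpace E] [BorelSpace E]
    (o : OrthonormalBasis ι ℝ E) (a : ι → ℝ) :
    volume (orthoBox o a) = ∏ i, ENNReal.ofReal (2 * a i) := by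
  have h : orthoBox o a = (fun x => WithLp.ofLp (o.repr x)) ⁻¹'
      (Set.univ.pi fun i => Set.Ioo (-a i) (a i)) := by
    ext x
    simp [orthoBox, abs_lt, o.repr_apply_apply]
  have hm : MeasurePreserving (fun x => WithLp.ofLp (o.repr x)) :=
    (PiLp.volume_preserving_ofLp ι).comp o.measurePreserving_repr
  rw [h, hm.measure_preimage (MeasurableSet.univ_pi fun i => measurableSet_Ioo).nullMeasurableSet,
    Real.volume_pi_Ioo]
  refine Finset.prod_congr rfl fun i _ => ?_
  congr 1
  ring

namespace EuclideanLattice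

/-- Minkowski's convex body theorem: the box is convex and symmetric, of volume `2 ^ r * ∏ i, a i`.
-/
theorem exists_ne_zero_mem_orthoBox (Λ : EuclideanLattice r)
    (o : OrthonormalBasis (Fin r) ℝ (EuclideanSpace ℝ (Fin r))) (a : Fin r → ℝ)
    (ha : ∀ i, 0 ≤ a i) (h : Λ.vol < ∏ i, a i) :
    ∃ x ∈ Λ.carrier, x ≠ 0 ∧ x ∈ orthoBox o a := by
  have hf : Module.Finite ℤ Λ.carrier := ZLattice.module_finite ℝ Λ.carrier
  have hfr : Module.Free ℤ Λ.carrier := ZLattice.module_free ℝ Λ.carrier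
  let b := Module.finBasis ℤ Λ.carrier
  have fund := ZLattice.isAddFundamentalDomain b volume
  have hvol : (volume (ZSpan.fundamentalDomain (b.ofZLatticeBasis ℝ))).toReal = Λ.vol :=
    (ZLattice.covolume_eq_measure_fundamentalDomain Λ.carrier volume fund).symm
  have hfin : volume (ZSpan.fundamentalDomain (b.ofZLatticeBasis ℝ)) ≠ ⊤ :=
    (ZSpan.fundamentalDomain_isBounded _).measure_lt_top.ne
  have hc : Countable Λ.carrier.toAddSubgroup := inferInstanceAs (Countable Λ.carrier)
  obtain ⟨x, hx0, hx⟩ := exists_ne_zero_mem_lattice_of_measure_mul_two_pow_lt_measure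
    (L := Λ.carrier.toAddSubgroup) (s := orthoBox o a) fund
    (fun x hx i => by simpa using hx i) (convex_orthoBox o a) (by
      rw [volume_orthoBox, ← ENNReal.ofReal_prod_of_nonneg (fun i _ => by have := ha i; positivity),
        ← ENNReal.ofReal_toReal hfin, hvol, finrank_euclideanSpace_fin, Finset.prod_mul_distrib,
        Finset.prod_const, Finset.card_univ, Fintype.card_fin,
        show (2 : ENNReal) = ENNReal.ofReal 2 by simp, ← ENNReal.ofReal_pow zero_le_two,
        ← ENNReal.ofReal_mul Λ.vol_pos.le, mul_comm]
      exact (ENNReal.ofReal_lt_ofReal_iff_of_nonneg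
        (mul_nonneg (by positivity) Λ.vol_pos.le)).mpr (by gcongr))
  exact ⟨x, x.2, fun h => hx0 (Subtype.ext h), hx⟩

/-- If the short vectors missed a direction `w`, Minkowski's theorem for a box long along `w` and
thin across it would give a short lattice vector; being orthogonal to `w`, it would have norm below
1. -/
theorem span_short_eq_top (hr : 0 < r) (Λ : EuclideanLattice r)
    (h1 : ∀ x ∈ Λ.carrier, x ≠ 0 → 1 ≤ ‖x‖) {V : ℝ} (hV : 0 ≤ V) (h2 : Λ.vol < V) :
    Submodule.span ℝ {x | x ∈ Λ.carrier ∧ ‖x‖ ≤ V * r ^ r + 1} = ⊤ := by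
  have hr0 : 0 < (r : ℝ) := by exact_mod_cast hr
  by_contra hW
  rw [← Submodule.orthogonal_eq_bot_iff] at hW
  obtain ⟨w, hw, hw0⟩ := Submodule.exists_mem_ne_zero_of_ne_bot hW
  let i₀ : Fin r := ⟨0, hr⟩
  obtain ⟨o, ho⟩ := Orthonormal.exists_orthonormalBasis_extension_of_card_eq (𝕜 := ℝ)
    (E := EuclideanSpace ℝ (Fin r)) (ι := Fin r) (by simp)
    (v := fun _ => (‖w‖⁻¹ : ℝ) • w) (s := {i₀}) (by
      rw [orthonormal_subsingleton_iff]
      intro i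
      simp [norm_smul, hw0])
  have ho0 : o i₀ = (‖w‖⁻¹ : ℝ) • w := ho i₀ rfl
  -- The thin sides contribute at most `(r - 1) / r < 1` to the norm, and the long side makes the
  -- product of the half sides `V * r`, which exceeds the volume.
  let a : Fin r → ℝ := fun i => if i = i₀ then V * r ^ r else (r : ℝ)⁻¹
  have ha : ∀ i, 0 ≤ a i := fun i => by
    simp only [a]
    split_ifs <;> positivity
  obtain ⟨x, hx, hx0, hxb⟩ := Λ.exists_ne_zero_mem_orthoBox o a ha (by
    have : ∏ i, a i = V * r := by
      rw [← Finset.mul_prod_erase _ _ (Finset.mem_univ i₀),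
        Finset.prod_congr rfl (fun i hi => if_neg (Finset.ne_of_mem_erase hi)),
        Finset.prod_const, Finset.card_erase_of_mem (Finset.mem_univ _), Finset.card_univ,
        Fintype.card_fin]
      simp only [a, if_true]
      obtain ⟨n, rfl⟩ := Nat.exists_eq_succ_of_ne_zero hr.ne'
      simp only [Nat.succ_eq_add_one, Nat.add_sub_cancel]
      rw [pow_succ, inv_pow]
      field_simp
    rw [this]
    have : (1 : ℝ) ≤ r := by exact_mod_cast hr
    nlinarith)
  have hb : ∀ i, i ≠ i₀ → |inner ℝ (o i) x| < (r : ℝ)⁻¹ := fun i hi => by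
    have := hxb i
    simpa [a, hi] using this
  have hsum : ∀ c : ℝ, |inner ℝ (o i₀) x| ≤ c →
      ‖x‖ ≤ c + (r - 1) * (r : ℝ)⁻¹ := by
    intro c hc
    refine (norm_le_sum_abs o x).trans ?_
    rw [← Finset.add_sum_erase _ _ (Finset.mem_univ i₀)]
    refine add_le_add hc ((Finset.sum_le_card_nsmul _ _ (r : ℝ)⁻¹
      fun i hi => (hb i (Finset.ne_of_mem_erase hi)).le).trans (le_of_eq ?_))
    rw [Finset.card_erase_of_mem (Finset.mem_univ _), Finset.card_univ, Fintype.card_fin,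
      nsmul_eq_mul, Nat.cast_sub hr, Nat.cast_one]
  have hlt : ((r : ℝ) - 1) * (r : ℝ)⁻¹ < 1 := by
    rw [sub_mul, mul_inv_cancel₀ hr0.ne']
    have := inv_pos.mpr hr0
    linarith
  have hmem : x ∈ Submodule.span ℝ {x | x ∈ Λ.carrier ∧ ‖x‖ ≤ V * r ^ r + 1} := by
    refine Submodule.subset_span ⟨hx, (hsum (V * r ^ r) ?_).trans (by linarith)⟩
    have := hxb i₀
    simp only [a, if_true] at this
    exact this.le
  have hz : inner ℝ (o i₀) x = 0 := by
    rw [ho0, inner_smul_left, Submodule.inner_left_of_mem_orthogonal hmem hw, mul_zero]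
  have h3 := hsum 0 (by rw [hz, abs_zero])
  linarith [h1 x hx hx0]

theorem exists_linearIndependent_short (hr : 0 < r) (Λ : EuclideanLattice r)
    (h1 : ∀ x ∈ Λ.carrier, x ≠ 0 → 1 ≤ ‖x‖) {V : ℝ} (hV : 0 ≤ V) (h2 : Λ.vol < V) :
    ∃ v : Fin r → EuclideanSpace ℝ (Fin r), LinearIndependent ℝ v ∧
      ∀ i, v i ∈ Λ.carrier ∧ ‖v i‖ ≤ V * r ^ r + 1 := by
  obtain ⟨b, hbs, hspan, hli⟩ := exists_linearIndependent ℝ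
    {x | x ∈ Λ.carrier ∧ ‖x‖ ≤ V * r ^ r + 1}
  rw [Λ.span_short_eq_top hr h1 hV h2] at hspan
  let B : Module.Basis b ℝ (EuclideanSpace ℝ (Fin r)) := Module.Basis.mk hli (by simp [hspan])
  let e : b ≃ Fin r := B.indexEquiv (EuclideanSpace.basisFun (Fin r) ℝ).toBasis
  exact ⟨fun i => e.symm i, hli.comp _ e.symm.injective, fun i => hbs (e.symm i).2⟩

/-- Semistability applied to the rank-one sublattice generated by `x`: `Vol Λ ≤ ‖x‖ ^ r`. -/
theorem IsSemistable.one_le_norm (hr : 0 < r) {Λ : EuclideanLattice r} (hΛ : Λ.IsSemistable)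
    (h : 1 ≤ Λ.vol) : ∀ x ∈ Λ.carrier, x ≠ 0 → 1 ≤ ‖x‖ := by
  intro x hx hx0
  have hd : (Matrix.gram ℝ fun _ : Fin 1 => x).det = ‖x‖ ^ 2 := by
    rw [Matrix.det_fin_one, Matrix.gram_apply, real_inner_self_eq_norm_sq]
  have := (isSemistable_iff Λ).mp hΛ 1 (fun _ => x) (fun _ => hx)
    (by rw [hd]; exact pow_ne_zero 2 (norm_ne_zero_iff.mpr hx0))
  rw [hd, Real.sqrt_sq (norm_nonneg x), pow_one] at this
  exact (one_le_pow_iff_of_nonneg (norm_nonneg x) hr.ne').mp (h.trans this)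

end EuclideanLattice

/-! ### Integer matrices of bounded determinant -/

/-- The quotient `N⁻¹ * M = 1 + N⁻¹ * (M - N)` is integral, because `m` clears the denominator
`N.det` of `N⁻¹`, and equality of determinants makes it unimodular. -/
theorem exists_mul_GL_eq {ι : Type*} [Fintype ι] [DecidableEq ι] {N M : Matrix ι ι ℤ} {m : ℤ}
    (hN : N.det ≠ 0) (hdet : N.det = M.det) (hm : N.det ∣ m) (h : ∀ i j, m ∣ M i j - N i j) :
    ∃ γ : GL ι ℤ, N * (γ : Matrix ι ι ℤ) = M := by
  choose X hX using h
  obtain ⟨q, rfl⟩ := hm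
  have h1 : N * (1 + q • (N.adjugate * Matrix.of X)) = M := by
    rw [mul_add, mul_one, Matrix.mul_smul, ← mul_assoc, Matrix.mul_adjugate, Matrix.smul_mul,
      one_mul]
    ext i j
    have := hX i j
    simp only [Matrix.add_apply, Matrix.smul_apply, Matrix.of_apply, smul_eq_mul]
    linarith
  have h2 : (1 + q • (N.adjugate * Matrix.of X)).det = 1 := by
    have := congrArg Matrix.det h1
    rw [Matrix.det_mul, ← hdet] at this
    exact mul_left_cancel₀ hN (by rw [this, mul_one])
  exact ⟨Matrix.GeneralLinearGroup.mk'' _ (by rw [h2]; exact isUnit_one), h1⟩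

/-- Up to the right action of `GL_n(ℤ)`, the nonsingular integer matrices of bounded determinant
have bounded inverses. -/
theorem exists_inv_bounded (ι : Type*) [Fintype ι] [DecidableEq ι] (D : ℕ) :
    ∃ C : ℝ, 0 ≤ C ∧ ∀ N : Matrix ι ι ℤ, N.det ≠ 0 → |N.det| ≤ D →
      ∃ γ : GL ι ℤ, ∀ i j, |((N * (γ : Matrix ι ι ℤ)).map (Int.cast : ℤ → ℝ))⁻¹ i j| ≤ C := by
  have : NeZero D.factorial := ⟨D.factorial_ne_zero⟩
  -- Matrices with the same determinant and the same residue modulo `D!` lie in one right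
  -- `GL_n(ℤ)`-orbit, since the determinant divides `D!`. There are finitely many such data, and one
  -- representative of each gives its bound.
  have key : ∀ t : Finset.Icc (-(D : ℤ)) D × Matrix ι ι (ZMod D.factorial),
      ∃ C : ℝ, 0 ≤ C ∧ ∀ N : Matrix ι ι ℤ, N.det ≠ 0 → N.det = t.1 → N.map Int.cast = t.2 →
      ∃ γ : GL ι ℤ, ∀ i j, |((N * (γ : Matrix ι ι ℤ)).map (Int.cast : ℤ → ℝ))⁻¹ i j| ≤ C := by
    intro t
    by_cases ht : ∃ M : Matrix ι ι ℤ, M.det = t.1 ∧ M.map Int.cast = t.2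
    · obtain ⟨M, hM1, hM2⟩ := ht
      refine ⟨∑ i, ∑ j, |(M.map (Int.cast : ℤ → ℝ))⁻¹ i j|, by positivity,
        fun N hN hN1 hN2 => ?_⟩
      have hD : N.det ∣ (D.factorial : ℤ) := by
        rw [← Int.natAbs_dvd_natAbs, Int.natAbs_natCast]
        have h3 := Finset.mem_Icc.mp t.1.2
        rw [← hN1] at h3
        exact Nat.dvd_factorial (Int.natAbs_pos.mpr hN) (by omega)
      obtain ⟨γ, hγ⟩ := exists_mul_GL_eq (M := M) hN (hN1.trans hM1.symm) hD (fun i j => by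
        rw [← ZMod.intCast_eq_intCast_iff_dvd_sub]
        exact congrFun (congrFun (hN2.trans hM2.symm) i) j)
      refine ⟨γ, fun i j => ?_⟩
      rw [hγ]
      exact (Finset.single_le_sum (f := fun j => |(M.map (Int.cast : ℤ → ℝ))⁻¹ i j|)
        (fun _ _ => abs_nonneg _) (Finset.mem_univ j)).trans
        (Finset.single_le_sum (f := fun i => ∑ j, |(M.map (Int.cast : ℤ → ℝ))⁻¹ i j|)
          (fun _ _ => by positivity) (Finset.mem_univ i))
    · exact ⟨0, le_rfl, fun N _ hN1 hN2 => absurd ⟨N, hN1, hN2⟩ ht⟩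
  choose C hC0 hC using key
  refine ⟨∑ t, C t, Finset.sum_nonneg fun t _ => hC0 t, fun N hN hD => ?_⟩
  let t : Finset.Icc (-(D : ℤ)) D × Matrix ι ι (ZMod D.factorial) :=
    (⟨N.det, Finset.mem_Icc.mpr (abs_le.mp hD)⟩, N.map Int.cast)
  obtain ⟨γ, hγ⟩ := hC t N hN rfl rfl
  exact ⟨γ, fun i j => (hγ i j).trans
    (Finset.single_le_sum (f := C) (fun t _ => hC0 t) (Finset.mem_univ t))⟩

/-! ### Bounded sets of invertible matrices -/

/-- The invertible matrices `g` such that the entries of `g` and of `g⁻¹` are bounded by `B`. -/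
def boundedGL (r : ℕ) (B : ℝ) : Set (GL (Fin r) ℝ) :=
  {g | ∀ i j, |(g : Matrix (Fin r) (Fin r) ℝ) i j| ≤ B ∧
    |((g⁻¹ : GL (Fin r) ℝ) : Matrix (Fin r) (Fin r) ℝ) i j| ≤ B}

/-- The map `g ↦ (g, g⁻¹)` is a closed embedding into a product of two matrix spaces, and the set is
the preimage of a product of compact boxes. -/
theorem isCompact_boundedGL (r : ℕ) (B : ℝ) : IsCompact (boundedGL r B) := by
  have hbox : IsCompact {A : Matrix (Fin r) (Fin r) ℝ | ∀ i j, |A i j| ≤ B} := by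
    have : {A : Matrix (Fin r) (Fin r) ℝ | ∀ i j, |A i j| ≤ B} =
        Set.univ.pi fun _ : Fin r => Set.univ.pi fun _ : Fin r => Set.Icc (-B) B := by
      ext A
      simp only [Set.mem_ofPred_eq, abs_le]
      exact ⟨fun h i _ j _ => h i j, fun h i j => h i trivial j trivial⟩
    rw [this]
    exact isCompact_univ_pi fun _ => isCompact_univ_pi fun _ => isCompact_Icc
  have h := Units.isClosedEmbedding_embedProduct.isCompact_preimage
    (hbox.prod (MulOpposite.opHomeomorph.isCompact_image.mpr hbox))
  convert h using 1
  ext g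
  simp only [boundedGL, Set.mem_ofPred_eq, Set.mem_preimage, Set.mem_prod, Units.embedProduct_apply,
    Set.mem_image, MulOpposite.opHomeomorph_apply, MulOpposite.op_inj, exists_eq_right]
  exact ⟨fun h => ⟨fun i j => (h i j).1, fun i j => (h i j).2⟩, fun h i j => ⟨h.1 i j, h.2 i j⟩⟩

theorem exists_adjugate_bounded (r : ℕ) (B : ℝ) : ∃ C : ℝ, ∀ A : Matrix (Fin r) (Fin r) ℝ,
    (∀ i j, |A i j| ≤ B) → ∀ i j, |A.adjugate i j| ≤ C := by
  -- An adjugate entry is the determinant of `A` with one row replaced by a unit vector, hence the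
  -- maximum with 1.
  refine ⟨(Fintype.card (Fin r)).factorial • (max B 1) ^ Fintype.card (Fin r), fun A hA i j => ?_⟩
  rw [Matrix.adjugate_apply]
  refine Matrix.det_le (abv := AbsoluteValue.abs) fun k l => ?_
  change |_| ≤ _
  rw [Matrix.updateRow_apply]
  split_ifs
  · rw [Pi.single_apply]
    split_ifs <;> simp
  · exact (hA k l).trans (le_max_left _ _)

theorem abs_mul_apply_le {A M : Matrix (Fin r) (Fin r) ℝ} {a b : ℝ} (hA : ∀ i j, |A i j| ≤ a)
    (hM : ∀ i j, |M i j| ≤ b) (i j : Fin r) : |(A * M) i j| ≤ r * (a * b) := by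
  rw [Matrix.mul_apply]
  refine (Finset.abs_sum_le_sum_abs _ _).trans ((Finset.sum_le_card_nsmul _ _ (a * b)
    fun k _ => ?_).trans (by simp))
  rw [abs_mul]
  exact mul_le_mul (hA i k) (hM k j) (abs_nonneg _) ((abs_nonneg _).trans (hA i k))

/-- Semistable lattices of volume between `1` and `V` have a basis in a compact set. -/
theorem exists_smul_mem_boundedGL (hr : 0 < r) {V : ℝ} (hV : 0 ≤ V) :
    ∃ B : ℝ, ∀ g : GL (Fin r) ℝ, (EuclideanLattice.ofGL g).IsSemistable →
      1 ≤ (EuclideanLattice.ofGL g).vol → (EuclideanLattice.ofGL g).vol < V →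
      ∃ γ : integralGL r, γ • g ∈ boundedGL r B := by
  set R : ℝ := V * r ^ r + 1 with hR
  have hR0 : 0 ≤ R := by positivity
  -- The bound `r! * R ^ r` is the Leibniz estimate for a determinant whose entries are at most `R`.
  obtain ⟨C, hC0, hC⟩ := exists_inv_bounded (Fin r)
    ⌊((Fintype.card (Fin r)).factorial • R ^ Fintype.card (Fin r) : ℝ)⌋₊
  obtain ⟨C', hC'⟩ := exists_adjugate_bounded r (r * (C * R))
  refine ⟨max (r * (C * R)) C', fun g hg h1 h2 => ?_⟩
  obtain ⟨v, hv, hvΛ⟩ := (EuclideanLattice.ofGL g).exists_linearIndependent_short hr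
    (hg.one_le_norm hr h1) hV h2
  choose n hn using fun i => (EuclideanLattice.mem_ofGL g).mp (hvΛ i).1
  let N : Matrix (Fin r) (Fin r) ℤ := Matrix.of n
  let W : Matrix (Fin r) (Fin r) ℝ := Matrix.of fun i j => v i j
  have hNg : N.map (Int.cast : ℤ → ℝ) * (g : Matrix (Fin r) (Fin r) ℝ) = W := by
    ext i j
    have := congrArg (fun x : EuclideanSpace ℝ (Fin r) => x j) (hn i)
    simpa [Matrix.vecMul, Matrix.mul_apply, dotProduct, N, W] using this
  have hW : ∀ i j, |W i j| ≤ R := fun i j =>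
    (PiLp.norm_apply_le (v i) j).trans (hvΛ i).2
  have hWdet : W.det ≠ 0 := by
    have h3 : LinearIndependent ℝ W.row :=
      hv.map' (WithLp.linearEquiv 2 ℝ (Fin r → ℝ)).toLinearMap (LinearEquiv.ker _)
    exact ((Matrix.isUnit_iff_isUnit_det W).mp
      (Matrix.linearIndependent_rows_iff_isUnit.mp h3)).ne_zero
  have hdet : (N.det : ℝ) * (g : Matrix (Fin r) (Fin r) ℝ).det = W.det := by
    rw [← hNg, Matrix.det_mul]
    congr 1
    exact (Int.castRingHom ℝ).map_det N
  have hN0 : N.det ≠ 0 := by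
    rintro h
    rw [h, Int.cast_zero, zero_mul] at hdet
    exact hWdet hdet.symm
  rw [EuclideanLattice.vol_ofGL] at h1
  -- This is the index of the sublattice spanned by the short vectors: `|N.det|` is `|W.det| / |det
  -- g|`, and `|det g| ≥ 1`.
  have hND : |N.det| ≤
      (⌊((Fintype.card (Fin r)).factorial • R ^ Fintype.card (Fin r) : ℝ)⌋₊ : ℤ) := by
    have h3 : |W.det| ≤ (Fintype.card (Fin r)).factorial • R ^ Fintype.card (Fin r) :=
      Matrix.det_le (abv := AbsoluteValue.abs) hW
    rw [← hdet, abs_mul] at h3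
    have h4 : ((N.det.natAbs : ℕ) : ℝ) ≤
        (Fintype.card (Fin r)).factorial • R ^ Fintype.card (Fin r) := by
      rw [Nat.cast_natAbs, Int.cast_abs]
      exact (le_mul_of_one_le_right (abs_nonneg _) h1).trans h3
    rw [Int.abs_eq_natAbs]
    exact_mod_cast Nat.le_floor h4
  obtain ⟨γ, hγ⟩ := hC N hN0 hND
  let γ' : GL (Fin r) ℝ := Matrix.GeneralLinearGroup.map (Int.castRingHom ℝ) γ
  have hγ' : (γ' : Matrix (Fin r) (Fin r) ℝ) = (γ : Matrix (Fin r) (Fin r) ℤ).map Int.cast := rfl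
  refine ⟨⟨γ', γ, rfl⟩⁻¹, ?_⟩
  -- The new basis satisfies `(N * γ) * k = W`, so it is the bounded matrix `(N * γ)⁻¹` times the
  -- bounded matrix `W`.
  set k : GL (Fin r) ℝ := γ'⁻¹ * g with hk
  change k ∈ boundedGL r _
  have hNγ : (N * (γ : Matrix (Fin r) (Fin r) ℤ)).map (Int.cast : ℤ → ℝ) =
      N.map (Int.cast : ℤ → ℝ) * (γ' : Matrix (Fin r) (Fin r) ℝ) := by
    rw [hγ']
    exact Matrix.map_mul (f := Int.castRingHom ℝ)
  have hmul : (N * (γ : Matrix (Fin r) (Fin r) ℤ)).map (Int.cast : ℤ → ℝ) *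
      (k : Matrix (Fin r) (Fin r) ℝ) = W := by
    rw [hNγ, ← hNg, mul_assoc, ← Units.val_mul, hk, mul_inv_cancel_left]
  have hunit : IsUnit ((N * (γ : Matrix (Fin r) (Fin r) ℤ)).map (Int.cast : ℤ → ℝ)).det := by
    refine isUnit_iff_ne_zero.mpr fun h => hWdet ?_
    rw [← hmul, Matrix.det_mul, h, zero_mul]
  have hkW : (k : Matrix (Fin r) (Fin r) ℝ) =
      ((N * (γ : Matrix (Fin r) (Fin r) ℤ)).map (Int.cast : ℤ → ℝ))⁻¹ * W := by
    rw [← hmul, Matrix.nonsing_inv_mul_cancel_left _ _ hunit]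
  have hkb : ∀ i j, |(k : Matrix (Fin r) (Fin r) ℝ) i j| ≤ r * (C * R) := by
    rw [hkW]
    exact abs_mul_apply_le hγ hW
  have hkdet : |(k : Matrix (Fin r) (Fin r) ℝ).det| =
      |(g : Matrix (Fin r) (Fin r) ℝ).det| := by
    have h3 : |(γ' : Matrix (Fin r) (Fin r) ℝ).det| = 1 := by
      have h4 : (γ' : Matrix (Fin r) (Fin r) ℝ).det =
          (((γ : Matrix (Fin r) (Fin r) ℤ).det : ℤ) : ℝ) :=
        ((Int.castRingHom ℝ).map_det (γ : Matrix (Fin r) (Fin r) ℤ)).symm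
      rw [h4]
      have h5 := Int.isUnit_iff_abs_eq.mp
        ((Matrix.isUnit_iff_isUnit_det _).mp (Units.isUnit γ))
      exact_mod_cast h5
    have h6 : (g : Matrix (Fin r) (Fin r) ℝ) =
        (γ' : Matrix (Fin r) (Fin r) ℝ) * (k : Matrix (Fin r) (Fin r) ℝ) := by
      rw [← Units.val_mul, hk, mul_inv_cancel_left]
    rw [h6, Matrix.det_mul, abs_mul, h3, one_mul]
  intro i j
  refine ⟨(hkb i j).trans (le_max_left _ _), ?_⟩
  -- The inverse is the adjugate divided by the determinant, and the determinant of `k` has absolute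
  -- value at least 1.
  rw [Matrix.coe_units_inv, Matrix.inv_def, Matrix.smul_apply, smul_eq_mul, abs_mul,
    Ring.inverse_eq_inv', abs_inv, hkdet]
  refine ((mul_le_of_le_one_left (abs_nonneg _) (inv_le_one_of_one_le₀ h1)).trans
    (hC' _ hkb i j)).trans (le_max_right _ _)

/-! ### Functions of a matrix -/

/-- The vector `n g` of the lattice `ℤ^r g`. -/
def rowVec (n : Fin r → ℤ) (g : GL (Fin r) ℝ) : EuclideanSpace ℝ (Fin r) :=
  WithLp.toLp 2 ((fun i => (n i : ℝ)) ᵥ* (g : Matrix (Fin r) (Fin r) ℝ))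

theorem continuous_rowVec (n : Fin r → ℤ) : Continuous (rowVec n) := by
  refine (PiLp.continuous_toLp 2 _).comp ?_
  exact Continuous.matrix_vecMul continuous_const Units.continuous_val

theorem rowVec_injective (g : GL (Fin r) ℝ) : Function.Injective fun n => rowVec n g := by
  intro m n h
  have h1 := congrArg WithLp.ofLp h
  simp only [rowVec] at h1
  have h2 := Matrix.vecMul_injective_of_isUnit (Units.isUnit g) h1
  funext i
  exact_mod_cast congrFun h2 i

theorem rowVec_zero (g : GL (Fin r) ℝ) : rowVec 0 g = 0 := by
  ext j
  simp [rowVec, Matrix.vecMul, dotProduct]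

theorem norm_rowVec_pos {n : Fin r → ℤ} (hn : n ≠ 0) (g : GL (Fin r) ℝ) : 0 < ‖rowVec n g‖ :=
  norm_pos_iff.mpr fun h => hn (rowVec_injective g (h.trans (rowVec_zero g).symm))

theorem norm_rowVec_le (n : Fin r → ℤ) {g h : GL (Fin r) ℝ} {B : ℝ}
    (hg : ∀ i j, |((g⁻¹ * h : GL (Fin r) ℝ) : Matrix (Fin r) (Fin r) ℝ) i j| ≤ B) :
    ‖rowVec n h‖ ≤ r * (r * B) * ‖rowVec n g‖ := by
  have h1 : ∀ j, |rowVec n h j| ≤ r * B * ‖rowVec n g‖ := by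
    intro j
    have h2 : rowVec n h j =
        (WithLp.ofLp (rowVec n g) ᵥ* ((g⁻¹ * h : GL (Fin r) ℝ) : Matrix (Fin r) (Fin r) ℝ)) j := by
      simp only [rowVec]
      rw [Matrix.vecMul_vecMul, ← Units.val_mul, mul_inv_cancel_left]
    rw [h2, Matrix.vecMul, dotProduct]
    refine (Finset.abs_sum_le_sum_abs _ _).trans ((Finset.sum_le_card_nsmul _ _
      (‖rowVec n g‖ * B) fun i _ => ?_).trans (le_of_eq ?_))
    · rw [abs_mul]
      exact mul_le_mul (PiLp.norm_apply_le (rowVec n g) i) (hg i j) (abs_nonneg _) (norm_nonneg _)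
    · simp
      ring
  refine (norm_le_sum_abs (EuclideanSpace.basisFun (Fin r) ℝ) _).trans
    ((Finset.sum_le_card_nsmul _ _ (r * B * ‖rowVec n g‖) fun j _ => ?_).trans (le_of_eq ?_))
  · simpa [EuclideanSpace.inner_single_left] using h1 j
  · simp
    ring

namespace EuclideanLattice

/-- The parametrization of the nonzero vectors of `ℤ^r g` by `ℤ^r`. -/
def ofGLEquiv (g : GL (Fin r) ℝ) :
    {n : Fin r → ℤ // n ≠ 0} ≃ {x : (ofGL g).carrier // x ≠ 0} :=
  (Equiv.ofBijective (fun n => (⟨rowVec n g, (mem_ofGL g).mpr ⟨n, rfl⟩⟩ : (ofGL g).carrier))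
    ⟨fun _ _ h => rowVec_injective g (congrArg Subtype.val h), fun x => by
      obtain ⟨n, hn⟩ := (mem_ofGL g).mp x.2
      exact ⟨n, Subtype.ext hn⟩⟩).subtypeEquiv fun n => by
    rw [not_iff_not]
    refine ⟨?_, fun h => rowVec_injective g ?_⟩
    · rintro rfl
      exact Subtype.ext (rowVec_zero g)
    · exact (congrArg Subtype.val h).trans (rowVec_zero g).symm

theorem measurable_theta_ofGL : Measurable fun g : GL (Fin r) ℝ => (ofGL g).theta 1 := by
  have h : (fun g : GL (Fin r) ℝ => (ofGL g).theta 1) = fun g =>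
      ∑' n : {n : Fin r → ℤ // n ≠ 0}, Real.exp (-Real.pi * ‖rowVec n g‖ ^ 2 * 1) := by
    funext g
    rw [theta, ← (ofGLEquiv g).tsum_eq]
    rfl
  rw [h]
  refine Measurable.tsum fun n => Continuous.measurable ?_
  have := continuous_rowVec (r := r) n
  fun_prop

theorem completedEpstein_ofGL (g : GL (Fin r) ℝ) (s : ℂ) :
    (ofGL g).completedEpstein s = (Real.pi : ℂ) ^ (-s) * Complex.Gamma s *
      ∑' n : {n : Fin r → ℤ // n ≠ 0}, (‖rowVec n g‖ : ℂ) ^ (-2 * s) := by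
  rw [completedEpstein, ← (ofGLEquiv g).tsum_eq]
  rfl

theorem measurable_completedEpstein_ofGL (s : ℂ) :
    Measurable fun g : GL (Fin r) ℝ => (ofGL g).completedEpstein s := by
  simp only [completedEpstein_ofGL]
  refine (Measurable.tsum fun n => ?_).const_mul _
  have : Measurable fun g => rowVec (r := r) n g := (continuous_rowVec (r := r) n).measurable
  fun_prop

theorem measurable_vol_ofGL : Measurable fun g : GL (Fin r) ℝ => (ofGL g).vol := by
  simp only [vol_ofGL]
  exact (Units.continuous_val.matrix_det.abs).measurable

/-- In the coordinates `n ↦ n g` the criterion becomes a countable intersection over integer tuples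
of measurable conditions on `g`, with the degenerate tuples allowed for by the union. -/
theorem measurableSet_isSemistable : MeasurableSet {g : GL (Fin r) ℝ | (ofGL g).IsSemistable} := by
  have h : {g : GL (Fin r) ℝ | (ofGL g).IsSemistable} =
      ⋂ (k : ℕ) (n : Fin k → Fin r → ℤ),
        {g | (Matrix.gram ℝ fun i => rowVec (n i) g).det = 0} ∪
        {g | (ofGL g).vol ^ k ≤ √(Matrix.gram ℝ fun i => rowVec (n i) g).det ^ r} := by
    ext g
    simp only [Set.mem_ofPred_eq, Set.mem_iInter, Set.mem_union, isSemistable_iff]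
    constructor
    · intro h k n
      exact or_iff_not_imp_left.mpr (h k _ fun i => (mem_ofGL g).mpr ⟨n i, rfl⟩)
    · intro h k v hv hd
      choose n hn using fun i => (mem_ofGL g).mp (hv i)
      have hvn : v = fun i => rowVec (n i) g := funext fun i => (hn i).symm
      rw [hvn] at hd ⊢
      exact (h k n).resolve_left hd
  rw [h]
  refine MeasurableSet.iInter fun k => MeasurableSet.iInter fun n => ?_
  have hm : Measurable fun g : GL (Fin r) ℝ => (Matrix.gram ℝ fun i => rowVec (n i) g).det := by
    refine Continuous.measurable (Continuous.matrix_det (continuous_matrix fun i j => ?_))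
    exact (continuous_rowVec (n i)).inner (continuous_rowVec (n j))
  exact (hm (measurableSet_singleton 0)).union
    (measurableSet_le (measurable_vol_ofGL.pow_const k) (hm.sqrt.pow_const r))

theorem carrier_ofGL_smul_le (γ : integralGL r) (g : GL (Fin r) ℝ) :
    (ofGL (γ • g)).carrier ≤ (ofGL g).carrier := by
  obtain ⟨_, γ, rfl⟩ := γ
  intro x hx
  obtain ⟨n, rfl⟩ := (mem_ofGL _).mp hx
  refine (mem_ofGL g).mpr ⟨n ᵥ* (γ : Matrix (Fin r) (Fin r) ℤ), ?_⟩
  change _ = WithLp.toLp 2 ((fun i => (n i : ℝ)) ᵥ*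
    ((γ : Matrix (Fin r) (Fin r) ℤ).map (Int.cast : ℤ → ℝ) * (g : Matrix (Fin r) (Fin r) ℝ)))
  rw [← Matrix.vecMul_vecMul]
  congr 2
  funext j
  simp [Matrix.vecMul, dotProduct]

theorem ofGL_smul (γ : integralGL r) (g : GL (Fin r) ℝ) : ofGL (γ • g) = ofGL g := by
  refine EuclideanLattice.ext (le_antisymm (carrier_ofGL_smul_le γ g) ?_)
  have := carrier_ofGL_smul_le γ⁻¹ (γ • g)
  rwa [inv_smul_smul] at this

/-- The completed Epstein zeta function is bounded on bounded sets of matrices. -/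
theorem exists_completedEpstein_le {s : ℂ} (hs : (r : ℝ) / 2 < s.re) (B : ℝ) :
    ∃ M : ℝ, ∀ g ∈ boundedGL r B, ‖(ofGL g).completedEpstein s‖ ≤ M := by
  have hsum : Summable fun n : {n : Fin r → ℤ // n ≠ 0} =>
      ‖rowVec n (1 : GL (Fin r) ℝ)‖ ^ (-2 * s.re) :=
    (ofGLEquiv (1 : GL (Fin r) ℝ)).summable_iff.mpr
      ((ofGL (1 : GL (Fin r) ℝ)).summable_norm_rpow_ne_zero (by linarith))
  set c : ℝ := r * (r * |B|) + 1 with hc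
  have hc0 : 0 < c := by positivity
  have hs0 : 0 ≤ s.re := le_trans (by positivity) hs.le
  refine ⟨‖(Real.pi : ℂ) ^ (-s) * Complex.Gamma s‖ * ∑' n : {n : Fin r → ℤ // n ≠ 0},
    c ^ (2 * s.re) * ‖rowVec n (1 : GL (Fin r) ℝ)‖ ^ (-2 * s.re), fun g hg => ?_⟩
  rw [completedEpstein_ofGL, norm_mul]
  refine mul_le_mul_of_nonneg_left (tsum_of_norm_bounded (hsum.mul_left _).hasSum fun n => ?_)
    (norm_nonneg _)
  have hpos : ∀ h : GL (Fin r) ℝ, 0 < ‖rowVec n h‖ := norm_rowVec_pos n.2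
  rw [Complex.norm_cpow_eq_rpow_re_of_pos (hpos g)]
  -- The bound on the entries of `g⁻¹` compares `n g` with `n` uniformly in `g`, so the series for
  -- `ℤ^r` dominates.
  have h1 : ‖rowVec n (1 : GL (Fin r) ℝ)‖ ≤ c * ‖rowVec n g‖ := by
    have h2 := norm_rowVec_le (g := g) (h := 1) (B := |B|) n
      (by rw [mul_one]; exact fun i j => (hg i j).2.trans (le_abs_self B))
    exact h2.trans (mul_le_mul_of_nonneg_right (by linarith) (norm_nonneg _))
  have h2 : (-2 * s).re = -(2 * s.re) := by simp
  rw [h2, neg_mul, Real.rpow_neg (hpos g).le, Real.rpow_neg (hpos 1).le, ← div_eq_mul_inv,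
    inv_le_comm₀ (Real.rpow_pos_of_pos (hpos g) _)
      (div_pos (Real.rpow_pos_of_pos hc0 _) (Real.rpow_pos_of_pos (hpos 1) _)), inv_div,
    div_le_iff₀ (Real.rpow_pos_of_pos hc0 _), ← Real.mul_rpow (hpos g).le hc0.le, mul_comm _ c]
  exact Real.rpow_le_rpow (hpos 1).le h1 (by positivity)

end EuclideanLattice

/-! ### Measurability on the moduli space -/

namespace Moduli

theorem ofGL_eq_mk (g : GL (Fin r) ℝ) : ofGL g = mk (EuclideanLattice.ofGL g) := rfl

theorem measurable_ofGL : Measurable (ofGL : GL (Fin r) ℝ → Moduli r) := fun _ h => h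

theorem measurable_of_comp_ofGL {β : Type*} [MeasurableSpace β] {f : Moduli r → β}
    (h : Measurable fun g => f (ofGL g)) : Measurable f := fun _ hs => h hs

theorem mk_mem_semistable {Λ : EuclideanLattice r} : mk Λ ∈ semistable r ↔ Λ.IsSemistable :=
  ⟨fun ⟨_, h, h'⟩ => h.of_isometric (Quotient.exact h'), fun h => ⟨Λ, h, rfl⟩⟩

theorem measurableSet_semistable : MeasurableSet (semistable r) := by
  change MeasurableSet (ofGL ⁻¹' semistable r)
  convert EuclideanLattice.measurableSet_isSemistable (r := r) using 1
  ext g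
  exact mk_mem_semistable

theorem measurable_vol : Measurable (vol : Moduli r → ℝ) :=
  measurable_of_comp_ofGL EuclideanLattice.measurable_vol_ofGL

theorem measurableSet_semistableOfVol (T : ℝ) : MeasurableSet (semistableOfVol r T) :=
  measurableSet_semistable.inter (measurable_vol (measurableSet_singleton T))

theorem measurable_completedEpstein (s : ℂ) :
    Measurable fun Λ : Moduli r => Λ.completedEpstein s :=
  measurable_of_comp_ofGL (EuclideanLattice.measurable_completedEpstein_ofGL s)

end Moduli

theorem measurable_zetaIntegrand (s : ℂ) : Measurable (zetaIntegrand (r := r) s) := by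
  refine Moduli.measurable_of_comp_ofGL ?_
  simp only [Moduli.ofGL_eq_mk, zetaIntegrand_mk]
  have h1 := EuclideanLattice.measurable_theta_ofGL (r := r)
  have h2 := EuclideanLattice.measurable_vol_ofGL (r := r)
  fun_prop

/-! ### Homotheties -/

/-- The scalar matrix of the homothety of ratio `exp (t / r)`. -/
def homothety (r : ℕ) (t : ℝ) : GL (Fin r) ℝ :=
  Matrix.GeneralLinearGroup.scalar (Fin r) (expUnit r t)

theorem coe_homothety_mul (t : ℝ) (g : GL (Fin r) ℝ) :
    ((homothety r t * g : GL (Fin r) ℝ) : Matrix (Fin r) (Fin r) ℝ) =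
      Real.exp (t / r) • (g : Matrix (Fin r) (Fin r) ℝ) := by
  rw [Units.val_mul, homothety, Matrix.GeneralLinearGroup.coe_scalar, Matrix.scalar_apply,
    ← Matrix.smul_eq_diagonal_mul]
  rfl

theorem continuous_homothety : Continuous (homothety r) := by
  have h : ∀ f : ℝ → ℝ, Continuous f →
      Continuous fun t => Matrix.scalar (Fin r) (f t) := fun f hf => by
    simp only [Matrix.scalar_apply]
    fun_prop
  refine Units.continuous_iff.mpr ⟨h (fun t => Real.exp (t / r)) (by fun_prop), ?_⟩
  have h2 : (fun t => (((homothety r t)⁻¹ : GL (Fin r) ℝ) : Matrix (Fin r) (Fin r) ℝ)) =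
      fun t => Matrix.scalar (Fin r) (Real.exp (t / r))⁻¹ := by
    funext t
    rw [homothety, ← map_inv, Matrix.GeneralLinearGroup.coe_scalar]
    rfl
  rw [h2]
  exact h _ (Continuous.inv₀ (by fun_prop) fun t => Real.exp_ne_zero _)

theorem homothety_mem_center (t : ℝ) : homothety r t ∈ Subgroup.center (GL (Fin r) ℝ) :=
  Subgroup.mem_center_iff.mpr fun g => (Matrix.GeneralLinearGroup.scalar_commute _ g).symm

theorem ofGL_homothety_mul (t : ℝ) (g : GL (Fin r) ℝ) :
    EuclideanLattice.ofGL (homothety r t * g) =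
      EuclideanLattice.scale (expUnit r t) (EuclideanLattice.ofGL g) := by
  ext x
  rw [EuclideanLattice.mem_scale, EuclideanLattice.mem_ofGL, EuclideanLattice.mem_ofGL]
  refine exists_congr fun n => ?_
  rw [coe_homothety_mul, Matrix.vecMul_smul, WithLp.toLp_smul,
    eq_inv_smul_iff₀ (Units.ne_zero _)]
  rfl

theorem vol_ofGL_homothety_mul (hr : 0 < r) (t : ℝ) (g : GL (Fin r) ℝ) :
    (EuclideanLattice.ofGL (homothety r t * g)).vol =
      Real.exp t * (EuclideanLattice.ofGL g).vol := by
  rw [ofGL_homothety_mul, EuclideanLattice.vol_scale_expUnit hr]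

/-! ### The decomposition of the measure -/

variable (ν : Measure (GL (Fin r) ℝ))

theorem isFundamentalDomain_fundamentalDomain :
    IsFundamentalDomain (integralGL r) (fundamentalDomain r) ν :=
  IsFundamentalDomain.mk' (exists_fundamentalDomain r).choose_spec.1.nullMeasurableSet
    (exists_fundamentalDomain r).choose_spec.2

theorem measurableSet_fundamentalDomain : MeasurableSet (fundamentalDomain r) :=
  (exists_fundamentalDomain r).choose_spec.1

/-- A central translate of a fundamental domain is again a fundamental domain, and a
`GL_r(ℤ)`-invariant set has the same measure in each of them; left invariance of the Haar measure
does the rest. -/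
theorem measure_preimage_homothety_inter [ν.IsHaarMeasure] (t : ℝ)
    {A : Set (GL (Fin r) ℝ)} (hA : MeasurableSet A)
    (hinv : ∀ (γ : integralGL r) (g), γ • g ∈ A ↔ g ∈ A) :
    ν ((homothety r t * ·) ⁻¹' A ∩ fundamentalDomain r) = ν (A ∩ fundamentalDomain r) := by
  have hF := isFundamentalDomain_fundamentalDomain ν
  let z : Subgroup.center (GL (Fin r) ℝ) := ⟨homothety r t, homothety_mem_center t⟩
  have hF' : IsFundamentalDomain (integralGL r) (z • fundamentalDomain r) ν := hF.smul_of_comm z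
  rw [hF.measure_set_eq hF' hA fun γ => Set.ext fun g => hinv γ g,
    ← measure_preimage_mul ν (homothety r t) (A ∩ _), Set.preimage_inter]
  congr 2
  ext g
  change _ ↔ z • g ∈ z • fundamentalDomain r
  rw [Set.smul_mem_smul_set_iff]

/-- The matrices whose lattice has volume in `[1, e)`. -/
def shell (r : ℕ) : Set (GL (Fin r) ℝ) :=
  {g | 1 ≤ (EuclideanLattice.ofGL g).vol ∧ (EuclideanLattice.ofGL g).vol < Real.exp 1}

theorem measurableSet_shell : MeasurableSet (shell r) :=
  (measurableSet_le measurable_const EuclideanLattice.measurable_vol_ofGL).inter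
    (measurableSet_lt EuclideanLattice.measurable_vol_ofGL measurable_const)

/-- The condition says that `t` lies in `(log Vol - 1, log Vol]`; this is the unit mass of `[1, e)`
for `dT / T`. -/
theorem volume_homothety_mem_shell (hr : 0 < r) (g : GL (Fin r) ℝ) :
    volume {t : ℝ | homothety r (-t) * g ∈ shell r} = 1 := by
  have h : {t : ℝ | homothety r (-t) * g ∈ shell r} =
      Set.Ioc (Real.log (EuclideanLattice.ofGL g).vol - 1)
        (Real.log (EuclideanLattice.ofGL g).vol) := by
    ext t
    simp only [shell, Set.mem_ofPred_eq, Set.mem_Ioc, vol_ofGL_homothety_mul hr]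
    have hv := (EuclideanLattice.ofGL g).vol_pos
    rw [Real.exp_neg, inv_mul_eq_div, one_le_div (Real.exp_pos t), div_lt_iff₀ (Real.exp_pos t),
      ← Real.exp_add, ← Real.le_log_iff_exp_le hv, ← Real.log_lt_iff_lt_exp hv, sub_lt_iff_lt_add',
      and_comm]
  rw [h, Real.volume_Ioc]
  simp

/-- The class of the lattice `exp (t / r) • ℤ^r g`. -/
def rayPoint (p : ℝ × GL (Fin r) ℝ) : Moduli r := Moduli.ofGL (homothety r p.1 * p.2)

theorem rayPoint_eq (t : ℝ) (g : GL (Fin r) ℝ) : rayPoint (t, g) =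
    Moduli.mk (EuclideanLattice.scale (expUnit r t) (EuclideanLattice.ofGL g)) := by
  rw [rayPoint, Moduli.ofGL_eq_mk, ofGL_homothety_mul]

theorem measurable_homothety_mul :
    Measurable fun p : ℝ × GL (Fin r) ℝ => homothety r p.1 * p.2 :=
  ((continuous_homothety.comp continuous_fst).mul continuous_snd).measurable

theorem measurable_rayPoint : Measurable (rayPoint (r := r)) :=
  Moduli.measurable_ofGL.comp measurable_homothety_mul

theorem sigmaFinite_of_isHaarMeasure [ν.IsHaarMeasure] : SigmaFinite ν := by
  have : LocallyCompactSpace (Matrix (Fin r) (Fin r) ℝ) :=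
    inferInstanceAs (LocallyCompactSpace (Fin r → Fin r → ℝ))
  infer_instance

/-- The measure on the space of lattices is the product of `dT / T` and of its restriction to
the shell of lattices of volume in `[1, e)`. -/
theorem measure_eq_map_rayPoint [ν.IsHaarMeasure] (hr : 0 < r) : Moduli.measure ν =
    (volume.prod (ν.restrict (shell r ∩ fundamentalDomain r))).map rayPoint := by
  have := sigmaFinite_of_isHaarMeasure ν
  refine Measure.ext fun A hA => ?_
  let A' : Set (GL (Fin r) ℝ) := Moduli.ofGL ⁻¹' A
  have hA' : MeasurableSet A' := Moduli.measurable_ofGL hA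
  rw [Moduli.measure, Measure.map_apply Moduli.measurable_ofGL hA,
    Measure.map_apply measurable_rayPoint hA, Measure.prod_apply (measurable_rayPoint hA)]
  let T : Set (ℝ × GL (Fin r) ℝ) := {p | p.2 ∈ A' ∧ homothety r (-p.1) * p.2 ∈ shell r}
  have hT : MeasurableSet T := (measurable_snd hA').inter
    ((measurable_homothety_mul.comp (measurable_fst.neg.prodMk measurable_snd))
      measurableSet_shell)
  -- Translation by the homothety moves the parameter `t` from the point of `A` to the shell
  -- condition, so that after exchanging the integrals only the length of a set of `t` remains.
  have hslice : ∀ t : ℝ, ν.restrict (shell r ∩ fundamentalDomain r)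
      (Prod.mk t ⁻¹' (rayPoint ⁻¹' A)) = ν.restrict (fundamentalDomain r) (Prod.mk t ⁻¹' T) := by
    intro t
    have hTt : MeasurableSet (Prod.mk t ⁻¹' T) := measurable_prodMk_left hT
    rw [Measure.restrict_apply (measurable_prodMk_left (measurable_rayPoint hA)),
      Measure.restrict_apply hTt, ← measure_preimage_homothety_inter ν t hTt, ← Set.inter_assoc]
    · congr 2
      ext g
      have h0 : homothety r (-t) * (homothety r t * g) = g := by
        have : homothety r (-t) * homothety r t = 1 := by
          rw [homothety, homothety, ← map_mul]
          have : expUnit r (-t) * expUnit r t = 1 := by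
            ext
            simp [expUnit, ← Real.exp_add, neg_div]
          rw [this, map_one]
        rw [← mul_assoc, this, one_mul]
      change (_ ∧ _) ↔ (_ ∧ homothety r (-t) * (homothety r t * g) ∈ shell r)
      rw [h0]
      rfl
    · intro γ g
      have h1 : homothety r (-t) * (γ • g) = γ • (homothety r (-t) * g) := by
        change _ * (_ * _) = _ * (_ * _)
        rw [← mul_assoc, ← mul_assoc,
          Subgroup.mem_center_iff.mp (homothety_mem_center (-t)) (γ : GL (Fin r) ℝ)]
      change (Moduli.ofGL (γ • g) ∈ A ∧ homothety r (-t) * (γ • g) ∈ shell r) ↔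
        (Moduli.ofGL g ∈ A ∧ homothety r (-t) * g ∈ shell r)
      rw [h1]
      simp only [shell, Set.mem_ofPred_eq, Moduli.ofGL_eq_mk, EuclideanLattice.ofGL_smul]
  simp only [hslice]
  rw [← Measure.prod_apply hT, Measure.prod_apply_symm hT]
  have hcol : ∀ g : GL (Fin r) ℝ, volume ((fun t => (t, g)) ⁻¹' T) = A'.indicator 1 g := by
    intro g
    by_cases hg : g ∈ A'
    · rw [Set.indicator_of_mem hg, Pi.one_apply, ← volume_homothety_mem_shell hr g]
      congr 1
      ext t
      exact and_iff_right hg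
    · rw [Set.indicator_of_notMem hg, ← measure_empty (μ := (volume : Measure ℝ))]
      congr 1
      ext t
      exact iff_of_false (fun h => hg h.1) (Set.notMem_empty t)
  simp only [hcol]
  rw [lintegral_indicator_one hA']

/-! ### The semistable part of the measure -/

/-- The restriction of the Haar measure to semistable representatives with volume in `[1, e)`. -/
def semistableShell : Measure (GL (Fin r) ℝ) :=
  ν.restrict ({g | (EuclideanLattice.ofGL g).IsSemistable} ∩ (shell r ∩ fundamentalDomain r))

theorem ae_semistableShell : ∀ᵐ g ∂semistableShell ν,
    (EuclideanLattice.ofGL g).IsSemistable ∧ g ∈ shell r := by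
  have h : MeasurableSet ({g : GL (Fin r) ℝ | (EuclideanLattice.ofGL g).IsSemistable} ∩
      (shell r ∩ fundamentalDomain r)) :=
    EuclideanLattice.measurableSet_isSemistable.inter
      (measurableSet_shell.inter measurableSet_fundamentalDomain)
  filter_upwards [ae_restrict_mem h] with g hg
  exact ⟨hg.1, hg.2.1⟩

/-- By reduction theory these representatives are covered by the pieces `γ • K ∩ F`, with `K`
compact and `F` the fundamental domain; the measures of the pieces add up to that of `K`. -/
theorem isFiniteMeasure_semistableShell [ν.IsHaarMeasure] (hr : 0 < r) :
    IsFiniteMeasure (semistableShell ν) := by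
  obtain ⟨B, hB⟩ := exists_smul_mem_boundedGL hr (Real.exp_pos 1).le
  refine ⟨?_⟩
  rw [semistableShell, Measure.restrict_apply_univ]
  have hF := isFundamentalDomain_fundamentalDomain ν
  refine lt_of_le_of_lt ?_ ((isCompact_boundedGL r B).measure_lt_top (μ := ν))
  rw [hF.measure_eq_tsum (boundedGL r B)]
  refine (measure_mono ?_).trans (measure_iUnion_le _)
  rintro g ⟨hg, hV, hgF⟩
  obtain ⟨γ, hγ⟩ := hB g hg hV.1 hV.2
  exact Set.mem_iUnion.mpr ⟨γ⁻¹, Set.mem_smul_set_iff_inv_smul_mem.mpr (by rwa [inv_inv]), hgF⟩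

theorem EuclideanLattice.isSemistable_scale_iff {Λ : EuclideanLattice r} {t : ℝˣ} :
    (scale t Λ).IsSemistable ↔ Λ.IsSemistable := by
  refine ⟨fun h => ?_, fun h => h.scale t⟩
  have h1 := h.scale t⁻¹
  have h2 : scale t⁻¹ (scale t Λ) = Λ := by
    ext x
    rw [mem_scale, mem_scale, smul_smul]
    simp
  rwa [h2] at h1

/-- Homothety invariance makes the semistable condition independent of the ray parameter, so it
restricts only the second factor. -/
theorem measure_restrict_semistable [ν.IsHaarMeasure] (hr : 0 < r) :
    (Moduli.measure ν).restrict (Moduli.semistable r) =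
      (volume.prod (semistableShell ν)).map rayPoint := by
  have := sigmaFinite_of_isHaarMeasure ν
  have h : rayPoint ⁻¹' Moduli.semistable r =
      Set.univ ×ˢ {g | (EuclideanLattice.ofGL g).IsSemistable} := by
    ext ⟨t, g⟩
    rw [Set.mem_preimage, rayPoint_eq, Moduli.mk_mem_semistable,
      EuclideanLattice.isSemistable_scale_iff]
    simp
  rw [measure_eq_map_rayPoint ν hr, Measure.restrict_map measurable_rayPoint
    Moduli.measurableSet_semistable, h, ← Measure.prod_restrict, Measure.restrict_univ,
    Measure.restrict_restrict EuclideanLattice.measurableSet_isSemistable, semistableShell]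

theorem Moduli.normalize_mk (Λ : EuclideanLattice r) : Moduli.normalize (mk Λ) = mk Λ.normalize :=
  rfl

/-- Normalizing is moving along the ray by the parameter `-log Vol`, which depends measurably on
`g`. -/
theorem Moduli.measurable_normalize : Measurable (Moduli.normalize (r := r)) := by
  refine measurable_of_comp_ofGL ?_
  have h : (fun g : GL (Fin r) ℝ => Moduli.normalize (Moduli.ofGL g)) = fun g =>
      rayPoint (-Real.log (EuclideanLattice.ofGL g).vol, g) := by
    funext g
    rw [rayPoint_eq, ofGL_eq_mk, normalize_mk, EuclideanLattice.normalize]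
    congr 2
    ext
    rw [Units.val_mk0, expUnit, Units.val_mk0, Real.rpow_def_of_pos (EuclideanLattice.vol_pos _)]
    congr 1
    ring
  rw [h]
  exact measurable_rayPoint.comp
    (EuclideanLattice.measurable_vol_ofGL.log.neg.prodMk measurable_id)

theorem EuclideanLattice.vol_normalize (hr : 0 < r) (Λ : EuclideanLattice r) :
    Λ.normalize.vol = 1 := by
  have hr' : (r : ℝ) ≠ 0 := by exact_mod_cast hr.ne'
  rw [normalize, vol_scale, Units.val_mk0, abs_of_pos (Real.rpow_pos_of_pos Λ.vol_pos _),
    ← Real.rpow_natCast, ← Real.rpow_mul Λ.vol_pos.le, neg_mul, one_div, inv_mul_cancel₀ hr',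
    Real.rpow_neg_one, inv_mul_cancel₀ Λ.vol_pos.ne']

theorem measureOne_restrict_semistableOfVol (hr : 0 < r) :
    (Moduli.measureOne ν).restrict (Moduli.semistableOfVol r 1) =
      (semistableShell ν).map fun g => Moduli.normalize (Moduli.ofGL g) := by
  have hn := Moduli.measurable_normalize (r := r)
  have hV : MeasurableSet {Λ : Moduli r | 1 ≤ Λ.vol ∧ Λ.vol < Real.exp 1} :=
    measurableSet_shell (r := r)
  have hS := Moduli.measurableSet_semistableOfVol (r := r) 1
  have h : {g : GL (Fin r) ℝ | (EuclideanLattice.ofGL g).IsSemistable} =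
      Moduli.ofGL ⁻¹' (Moduli.normalize ⁻¹' Moduli.semistableOfVol r 1) := by
    ext g
    simp only [Set.mem_preimage, Moduli.ofGL_eq_mk, Moduli.normalize_mk, Moduli.semistableOfVol,
      Set.mem_ofPred_eq, Moduli.mk_mem_semistable]
    refine ⟨fun h => ⟨h.scale _, EuclideanLattice.vol_normalize hr _⟩,
      fun h => EuclideanLattice.isSemistable_scale_iff.mp h.1⟩
  rw [Moduli.measureOne, Measure.restrict_map hn hS, Measure.restrict_restrict (hn hS),
    Moduli.measure, Measure.restrict_map Moduli.measurable_ofGL ((hn hS).inter hV),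
    Measure.map_map hn Moduli.measurable_ofGL,
    Measure.restrict_restrict (Moduli.measurable_ofGL ((hn hS).inter hV)), Set.preimage_inter, ← h,
    semistableShell, Set.inter_assoc]
  rfl

/-! ### Integrability -/

theorem exists_completedEpstein_normalize_le (hr : 0 < r) {s : ℂ} (hs : 1 < s.re) :
    ∃ M : ℝ, ∀ g : GL (Fin r) ℝ, (EuclideanLattice.ofGL g).IsSemistable → g ∈ shell r →
      ‖(EuclideanLattice.ofGL g).normalize.completedEpstein ((r : ℂ) / 2 * s)‖ ≤ M := by
  obtain ⟨B, hB⟩ := exists_smul_mem_boundedGL hr (Real.exp_pos 1).le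
  obtain ⟨M, hM⟩ := EuclideanLattice.exists_completedEpstein_le
    (EuclideanLattice.half_lt_re hr hs) B
  refine ⟨Real.exp 1 ^ s.re * M, fun g hg hV => ?_⟩
  obtain ⟨γ, hγ⟩ := hB g hg hV.1 hV.2
  have h1 := hM _ hγ
  rw [EuclideanLattice.ofGL_smul] at h1
  have hv := (EuclideanLattice.ofGL g).vol_pos
  rw [EuclideanLattice.completedEpstein_normalize hr, norm_mul,
    Complex.norm_cpow_eq_rpow_re_of_pos hv]
  exact mul_le_mul (Real.rpow_le_rpow hv.le hV.2.le (by linarith)) h1 (norm_nonneg _)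
    (by positivity)

theorem integrable_completedEpstein_normalize [ν.IsHaarMeasure] (hr : 0 < r)
    {s : ℂ} (hs : 1 < s.re) :
    Integrable (fun g => (EuclideanLattice.ofGL g).normalize.completedEpstein ((r : ℂ) / 2 * s))
      (semistableShell ν) := by
  have := isFiniteMeasure_semistableShell ν hr
  obtain ⟨M, hM⟩ := exists_completedEpstein_normalize_le hr hs
  refine Integrable.of_bound (C := M) ?_ ?_
  · exact ((Moduli.measurable_completedEpstein ((r : ℂ) / 2 * s)).comp
      (Moduli.measurable_normalize.comp Moduli.measurable_ofGL)).aestronglyMeasurable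
  · filter_upwards [ae_semistableShell ν] with g hg
    exact hM g hg.1 hg.2

/-- Tonelli's criterion with the ray integrated first: each ray converges by the Mellin transform,
and the integrals of the modulus are the norms of Epstein values at `s.re`, bounded on a space of
finite measure. -/
theorem integrable_zetaIntegrand_rayPoint [ν.IsHaarMeasure] (hr : 0 < r) {s : ℂ} (hs : 1 < s.re) :
    Integrable (fun p => zetaIntegrand s (rayPoint p)) (volume.prod (semistableShell ν)) := by
  have := isFiniteMeasure_semistableShell ν hr
  have hm : Measurable fun p : ℝ × GL (Fin r) ℝ => zetaIntegrand s (rayPoint p) :=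
    (measurable_zetaIntegrand s).comp measurable_rayPoint
  rw [integrable_prod_iff' hm.aestronglyMeasurable]
  simp only [rayPoint_eq]
  refine ⟨Filter.Eventually.of_forall fun g =>
    EuclideanLattice.integrable_zetaIntegrand_scale hr hs _, ?_⟩
  simp only [EuclideanLattice.integral_norm_zetaIntegrand_scale hr hs]
  exact ((integrable_completedEpstein_normalize ν hr
    (s := (s.re : ℂ)) (by simpa using hs)).const_mul _).norm

end NonAbelianZeta

end

/-! ### The integral formula for the zeta function -/

theorem mainTheorem9 (r : ℕ) (hr : 0 < r)
    (ν : MeasureTheory.Measure (GL (Fin r) ℝ)) [ν.IsHaarMeasure]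
    (s : ℂ) (hs : 1 < s.re) :
    (∀ Λ : NonAbelianZeta.EuclideanLattice r,
      Summable fun x : Λ.carrier => Real.exp (-Real.pi * ‖x‖ ^ 2)) ∧
    (∀ Λ : NonAbelianZeta.EuclideanLattice r,
      Summable fun x : {x : Λ.carrier // x ≠ 0} =>
        (‖(x : Λ.carrier)‖ : ℂ) ^ (-2 * ((r : ℂ) / 2 * s))) ∧
    MeasureTheory.IntegrableOn (NonAbelianZeta.zetaIntegrand s)
      (NonAbelianZeta.Moduli.semistable r) (NonAbelianZeta.Moduli.measure ν) ∧
    MeasureTheory.IntegrableOn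
      (fun Λ : NonAbelianZeta.Moduli r => Λ.completedEpstein ((r : ℂ) / 2 * s))
      (NonAbelianZeta.Moduli.semistableOfVol r 1) (NonAbelianZeta.Moduli.measureOne ν) ∧
    NonAbelianZeta.nonAbelianZeta r ν s =
      (r : ℂ) / 2 * ∫ Λ in NonAbelianZeta.Moduli.semistableOfVol r 1,
        Λ.completedEpstein ((r : ℂ) / 2 * s) ∂(NonAbelianZeta.Moduli.measureOne ν) := by
  open NonAbelianZeta in
  have hfin := isFiniteMeasure_semistableShell ν hr
  have hzm := (measurable_zetaIntegrand (r := r) s).aestronglyMeasurable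
    (μ := (volume.prod (semistableShell ν)).map rayPoint)
  have hnm : Measurable fun g : GL (Fin r) ℝ => Moduli.normalize (Moduli.ofGL g) :=
    Moduli.measurable_normalize.comp Moduli.measurable_ofGL
  have hem := (Moduli.measurable_completedEpstein (r := r) ((r : ℂ) / 2 * s)).aestronglyMeasurable
    (μ := (semistableShell ν).map fun g => Moduli.normalize (Moduli.ofGL g))
  have hint := integrable_zetaIntegrand_rayPoint ν hr hs
  refine ⟨fun Λ => Λ.summable_gaussian Real.pi_pos,
    fun Λ => Λ.summable_epstein (EuclideanLattice.half_lt_re hr hs), ?_, ?_, ?_⟩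
  · rw [IntegrableOn, measure_restrict_semistable ν hr,
      integrable_map_measure hzm measurable_rayPoint.aemeasurable]
    exact hint
  · rw [IntegrableOn, measureOne_restrict_semistableOfVol ν hr,
      integrable_map_measure hem hnm.aemeasurable]
    exact integrable_completedEpstein_normalize ν hr hs
  -- Both integrals are pulled back to `semistableShell`; Fubini with the ray variable innermost
  -- leaves the ray integral, already known to be `r / 2` times the Epstein value.
  · rw [nonAbelianZeta, measure_restrict_semistable ν hr,
      integral_map measurable_rayPoint.aemeasurable hzm, integral_prod_symm _ hint,
      measureOne_restrict_semistableOfVol ν hr, integral_map hnm.aemeasurable hem]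
    simp only [rayPoint_eq, EuclideanLattice.integral_zetaIntegrand_scale hr hs]
    exact integral_const_mul _ _
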